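/- Let $d\ge 2$, let $D\subset\mathbb R^d$ be a bounded polytopal domain and let $\mathcal T$ be a regular simplicial partition of $D$: a finite set of $d$-simplices with union $\overline D$, any two of which intersect in the (possibly empty) simplex spanned by their common vertices. Fix a tail for each edge and a unit normal for each face of $\mathcal T$. **Finite element space.** Let $\blacklozenge=\blacklozenge_1\times\dots\times\blacklozenge_m$, where each $\blacklozenge_k$ is one of the lowest order spaces $S_1$ (continuous, piecewise affine), $N_0$ (Nédélec: piecewise $w+Bx$, $B$ skew-symmetric, with continuous tangential traces on common subsimplices), $RT_0$ (Raviart–Thomas: piecewise $w+\beta x$, with continuous normal components across interior faces), $S_0$ (piecewise constant) on $\mathcal T$, or the subspace of one of these in which the degrees of freedom outside a given set $\mathcal I_k$ of vertices, edges, faces or cells, respectively, vanish (homogeneous essential boundary conditions). Let $\theta_i$, $i\in\mathcal I=\bigcup_k \mathcal I_k\times\{k\}$, be the usual shape functions: nodal hat functions, $\lambda_a\nabla\lambda_b-\lambda_b\nabla\lambda_a$ for the edge from $a$ to $b$, face functions with unit normal component on their face, and indicator functions of cells. **FoSLS networks.** For $v=\sum_{i\in\mathcal I}v_i\theta_i\in\blacklozenge$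 let $\Phi^{\blacklozenge,v}$ be the following feedforward network of depth $5$ with activations $\rho(t)=\max\{0,t\}$ and $\sigma=1_{(0,\infty)}$. For every $i\in\mathcal I$ and every cell $K$ that contains the subsimplex of $i$ it has a subnetwork. This subnetwork computes $\sigma(\lambda_{K,a}(x))$ for all vertices $a$ of $K$ and $y=\sigma\big(\sum_a\sigma(\lambda_{K,a}(x))-(d+1-\tfrac14)\big)$, where $\lambda_{K,a}$ are the barycentric coordinates of $K$. It passes the affine piece $z(x)=\theta_i|_K(x)$ through the first three layers as $\rho(\pm z)$, and $y$ through the third as $\rho(\pm y)$. In layer four it forms $\rho(\pm z-\kappa(1-y))$ componentwise, with $\kappa=\|z\|_{L^\infty(D)}$. The output layer sums, over all $i=(j,k)$ and $K$, the vectors $v_i\big(\rho(z-\kappa(1-y))-\rho(-z-\kappa(1-y))\big)$ in component $k$. Let $\mathcal{NN}(\blacklozenge;\mathcal T,D)=\{\Phi^{\blacklozenge,v}:v\in\blacklozenge\}$ and let $\mathrm R(\Phi)$ be the realization of $\Phi$. **Least squares problem.** Let $\mathbb V$ be a real Hilbert space of (a.e. equivalence classes of) vector-valued functions on $D$ which contains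 $\blacklozenge$; write $\mathbb V_\bullet=\blacklozenge\subset\mathbb V$. Let $\mathbb L=L^2(D_1)\times\dots\times L^2(D_n)$ with its Hilbert norm, let $\boldsymbol L:\mathbb V\to\mathbb L$ be bounded and linear, and let $0<c_{\boldsymbol L}\le C_{\boldsymbol L}<\infty$ satisfy $c_{\boldsymbol L}\|v\|_{\mathbb V}\le\|\boldsymbol Lv\|_{\mathbb L}\le C_{\boldsymbol L}\|v\|_{\mathbb V}$ for all $v\in\mathbb V$. Let $F\in\operatorname{range}(\boldsymbol L)$ and $\boldsymbol LU=F$ with $U\in\mathbb V$. **Claim.** Every $\Phi\in\mathcal{NN}(\blacklozenge;\mathcal T,D)$ has $\mathrm R(\Phi)\in\mathbb V$ (as an a.e. class on $D$), $\mathrm R$ is a bijection from $\mathcal{NN}(\blacklozenge;\mathcal T,D)$ onto $\mathbb V_\bullet$, and $$c_{\boldsymbol L}\|U-\mathrm R(\Phi)\|_{\mathbb V}\le\|F-\boldsymbol L\,\mathrm R(\Phi)\|_{\mathbb L}\le C_{\boldsymbol L}\|U-\mathrm R(\Phi)\|_{\mathbb V}\qquad\text{for all }\Phi\in\mathcal{NN}(\blacklozenge;\mathcal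 T,D).$$ The functional $\Phi\mapsto\|F-\boldsymbol L\,\mathrm R(\Phi)\|_{\mathbb L}^2$ has exactly one minimizer $\Phi_\bullet$ in $\mathcal{NN}(\blacklozenge;\mathcal T,D)$, all the minima below are attained, and $$c_{\boldsymbol L}\|U-\mathrm R(\Phi_\bullet)\|_{\mathbb V}\le\|F-\boldsymbol L\,\mathrm R(\Phi_\bullet)\|_{\mathbb L}=\min_{\Phi\in\mathcal{NN}(\blacklozenge;\mathcal T,D)}\|F-\boldsymbol L\,\mathrm R(\Phi)\|_{\mathbb L}\le C_{\boldsymbol L}\min_{\Phi\in\mathcal{NN}(\blacklozenge;\mathcal T,D)}\|U-\mathrm R(\Phi)\|_{\mathbb V}=C_{\boldsymbol L}\min_{v_\bullet\in\mathbb V_\bullet}\|U-v_\bullet\|_{\mathbb V}.$$ In particular $\|U-\mathrm R(\Phi_\bullet)\|_{\mathbb V}\le\frac{C_{\boldsymbol L}}{c_{\boldsymbol L}}\min_{v_\bullet\in\mathbb V_\bullet}\|U-v_\bullet\|_{\mathbb V}$. -/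

import Mathlib

open MeasureTheory Matrix
open scoped Classical

noncomputable section

/-! ### Feedforward neural networks -/

/-- The rectified linear unit. -/
def relu (x : ℝ) : ℝ := max 0 x

/-- The binary step unit (Heaviside function). -/
def bisu (x : ℝ) : ℝ := if x ≤ 0 then 0 else 1

/-- Feedforward neural networks with input nodes `α` and output nodes `γ`: a finite sequence of
weight matrices, bias vectors and lists of activation functions.  The nodes of every layer are
indexed by a finite type; every hidden node carries its own activation function, and the output
layer carries none. -/
inductive NeuralNet : Type → Type → Type 1
  | output {α γ : Type} [Fintype α] [Fintype γ]
      (A : Matrix γ α ℝ) (b : γ → ℝ) : NeuralNet α γ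
  | hidden {α β γ : Type} [Fintype α] [Fintype β]
      (A : Matrix β α ℝ) (b : β → ℝ) (ϱ : β → ℝ → ℝ) (Φ : NeuralNet β γ) : NeuralNet α γ

/-- The realization of a network. -/
def NeuralNet.realize : {α γ : Type} → NeuralNet α γ → (α → ℝ) → (γ → ℝ)
  | _, _, @NeuralNet.output _ _ _ _ A b, x => A *ᵥ x + b
  | _, _, @NeuralNet.hidden _ _ _ _ _ A b ϱ Φ, x => Φ.realize fun i => ϱ i ((A *ᵥ x + b) i)

/-! ### Regular simplicial partitions -/

/-- `ℝ^d` with the Euclidean norm. -/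
abbrev Eu (d : ℕ) : Type := EuclideanSpace ℝ (Fin d)

/-- A regular simplicial partition of `D`.  A cell is given by its set of `d + 1` affinely
independent vertices, the (closed) simplex being the convex hull.  Two simplices meet in the
simplex spanned by their common vertices (possibly empty); in particular the interiors of
distinct simplices are disjoint. -/
structure RegularPartition {d : ℕ} (D : Set (Eu d)) where
  cells : Finset (Finset (Eu d))
  card_cell : ∀ K ∈ cells, K.card = d + 1
  indep : ∀ K ∈ cells, AffineIndependent ℝ ((↑) : K → Eu d)
  cover : ⋃ K ∈ cells, convexHull ℝ (K : Set (Eu d)) = closure D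
  regular : ∀ K ∈ cells, ∀ K' ∈ cells,
    convexHull ℝ (K : Set (Eu d)) ∩ convexHull ℝ (K' : Set (Eu d)) =
      convexHull ℝ ((K ∩ K' : Finset (Eu d)) : Set (Eu d))

namespace RegularPartition

variable {d : ℕ} {D : Set (Eu d)} (T : RegularPartition D)

/-- The subsimplices of the partition with `j` vertices: vertices for `j = 1`, edges for `j = 2`,
faces for `j = d`, and the cells themselves for `j = d + 1`. -/
def subsimplices (j : ℕ) : Finset (Finset (Eu d)) :=
  T.cells.biUnion fun K => K.powersetCard j

/-- The vertices of a cell as an affine basis of `ℝ^d`. -/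
def basis (K : T.cells) : AffineBasis (K : Finset (Eu d)) ℝ (Eu d) where
  toFun := (↑)
  ind' := T.indep K K.2
  tot' := by
    rw [(T.indep K K.2).affineSpan_eq_top_iff_card_eq_finrank_add_one]
    simp [T.card_cell K K.2]

/-- The barycentric coordinate of the cell `K` that belongs to its vertex `a`. -/
def bary (K : T.cells) (a : Eu d) (x : Eu d) : ℝ :=
  if h : a ∈ (K : Finset (Eu d)) then (T.basis K).coord ⟨a, h⟩ x else 0

/-- The (constant) gradient of a barycentric coordinate. -/
def gradBary (K : T.cells) (a : Eu d) (j : Fin d) : ℝ :=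
  T.bary K a (EuclideanSpace.single j 1) - T.bary K a 0

/-- An orientation of all edges (a tail for each edge) and of all faces (a unit normal). -/
structure Orientation where
  tail : Finset (Eu d) → Eu d
  tail_mem : ∀ e ∈ T.subsimplices 2, tail e ∈ e
  normal : Finset (Eu d) → Eu d
  norm_normal : ∀ f ∈ T.subsimplices d, ‖normal f‖ = 1
  normal_orth : ∀ f ∈ T.subsimplices d, ∀ y ∈ f, ∀ z ∈ f, inner ℝ (normal f) (y - z) = 0

end RegularPartition

/-! ### Lowest order finite elements of the de Rham complex -/

/-- Continuous piecewise linear, lowest order Nédélec, lowest order Raviart-Thomas, and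
piecewise constant finite elements. -/
inductive FEKind
  | S1 | N0 | RT0 | S0

namespace FEKind

/-- The number of components of the functions. -/
@[reducible] def comps (d : ℕ) : FEKind → ℕ
  | S1 => 1
  | N0 => d
  | RT0 => d
  | S0 => 1

/-- The number of vertices of the subsimplices that carry the degrees of freedom. -/
def nverts (d : ℕ) : FEKind → ℕ
  | S1 => 1
  | N0 => 2
  | RT0 => d
  | S0 => d + 1

variable {d : ℕ}

/-- The local polynomial space on a simplex: affine functions; fields `w + B x` with `B` skew;
fields `w + β x` with a scalar `β`; constants. -/
def IsLocal : (k : FEKind) → (Eu d → Fin (k.comps d) → ℝ) → Prop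
  | S1, p => ∃ (g : Eu d →ₗ[ℝ] ℝ) (r : ℝ), ∀ x j, p x j = g x + r
  | N0, p => ∃ (w : Fin d → ℝ) (B : Matrix (Fin d) (Fin d) ℝ), Bᵀ = -B ∧
      ∀ x j, p x j = w j + ∑ l, B j l * x l
  | RT0, p => ∃ (w : Fin d → ℝ) (β : ℝ), ∀ x j, p x j = w j + β * x j
  | S0, p => ∃ r : ℝ, ∀ x j, p x j = r

/-- `p` and `q` have the same trace on the simplex spanned by `s`: the same values for `S1` and
`S0`, the same tangential components for `N0`, the same normal components for `RT0`. -/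
def SameTrace : (k : FEKind) → Finset (Eu d) → (p q : Eu d → Fin (k.comps d) → ℝ) → Prop
  | S1, s, p, q => ∀ x ∈ convexHull ℝ (s : Set (Eu d)), p x = q x
  | N0, s, p, q => ∀ x ∈ convexHull ℝ (s : Set (Eu d)), ∀ y ∈ s, ∀ z ∈ s,
      ∑ j, p x j * (y - z) j = ∑ j, q x j * (y - z) j
  | RT0, s, p, q => ∀ x ∈ convexHull ℝ (s : Set (Eu d)), ∀ ν : Eu d,
      (∀ y ∈ s, ∀ z ∈ s, inner ℝ ν (y - z) = 0) → ∑ j, p x j * ν j = ∑ j, q x j * ν j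
  | S0, s, p, q => ∀ x ∈ convexHull ℝ (s : Set (Eu d)), p x = q x

/-- The restriction to the cell `K` of the shape function of the subsimplex `s ⊆ K`: the hat
function of a vertex; the edge function `λ_a ∇λ_b - λ_b ∇λ_a` of the edge with tail `a` and head
`b` (its circulation along the edge is one); the face function that is a multiple of `x - a`, for
the vertex `a` opposite to the face, with normal component one on the face; the constant one. -/
def shape {D : Set (Eu d)} {T : RegularPartition D} (o : T.Orientation) :
    (k : FEKind) → Finset (Eu d) → T.cells → Eu d → Fin (k.comps d) → ℝ
  | S1, s, K, x, _ => ∑ a ∈ s, T.bary K a x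
  | N0, s, K, x, j => ∑ b ∈ s.erase (o.tail s),
      (T.bary K (o.tail s) x * T.gradBary K b j - T.bary K b x * T.gradBary K (o.tail s) j)
  | RT0, s, K, x, j => ∑ a ∈ (K : Finset (Eu d)) \ s,
      (-∑ l, o.normal s l * T.gradBary K a l) * (x j - a j)
  | S0, _, _, _, _ => 1

end FEKind

/-! ### Cartesian products of finite element spaces, and the networks that emulate them -/

/-- The data of a finite element space `♦ = ♦₁ × ⋯ × ♦ₘ` on one partition: the kind of each
factor, and for each factor the set of the subsimplices whose degree of freedom is not
constrained to zero.  Taking all subsimplices of the right dimension gives the full space;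
homogeneous essential boundary conditions are imposed by leaving out those on (a part of) the
boundary. -/
structure FESystem {d : ℕ} {D : Set (Eu d)} (T : RegularPartition D) (m : ℕ) where
  kind : Fin m → FEKind
  index : Fin m → Finset (Finset (Eu d))
  index_subset : ∀ k, index k ⊆ T.subsimplices ((kind k).nverts d)

namespace FESystem

variable {d : ℕ} {D : Set (Eu d)} {T : RegularPartition D} {m : ℕ} (S : FESystem T m)

/-- The scalar components of the functions in `♦₁ × ⋯ × ♦ₘ`. -/
abbrev Comp : Type := Σ k : Fin m, Fin ((S.kind k).comps d)

/-- The function `f` belongs (up to a null set of `D`) to `♦₁ × ⋯ × ♦ₘ`.  In each factor it is on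
each cell `K` a function `p K` of the local space, the pieces have the same trace (values,
tangential components, normal components) on the common subsimplex of any two cells if this
carries degrees of freedom, and the trace vanishes on the subsimplices outside the index set. -/
def IsFE (f : Eu d → S.Comp → ℝ) : Prop :=
  ∀ k : Fin m, ∃ p : Finset (Eu d) → Eu d → Fin ((S.kind k).comps d) → ℝ,
    (∀ K ∈ T.cells, (S.kind k).IsLocal (p K)) ∧
    (∀ K ∈ T.cells, ∀ K' ∈ T.cells, (S.kind k).nverts d ≤ (K ∩ K').card →
      (S.kind k).SameTrace (K ∩ K') (p K) (p K')) ∧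
    (∀ s ∈ T.subsimplices ((S.kind k).nverts d), s ∉ S.index k →
      ∀ K ∈ T.cells, s ⊆ K → (S.kind k).SameTrace s (p K) 0) ∧
    ∀ᵐ x ∂volume.restrict D, ∀ K ∈ T.cells, x ∈ convexHull ℝ (K : Set (Eu d)) →
      ∀ j, f x ⟨k, j⟩ = p K x j

/-- The index set of the shape functions of the product space. -/
abbrev Dof : Type := Σ k : Fin m, S.index k

/-- The subnetworks: one for each factor, each of its shape functions, and each cell that
contains the subsimplex of the shape function. -/
abbrev Block : Type :=
  Σ k : Fin m, ((S.index k ×ˢ T.cells).filter fun q => q.1 ⊆ q.2 : Finset _)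

/-- The shape function of a subnetwork. -/
def Block.dof {S : FESystem T m} (u : S.Block) : S.Dof :=
  ⟨u.1, u.2.1.1, (Finset.mem_product.1 (Finset.mem_filter.1 u.2.2).1).1⟩

/-- The cell of a subnetwork. -/
def Block.cell {S : FESystem T m} (u : S.Block) : T.cells :=
  ⟨u.2.1.2, (Finset.mem_product.1 (Finset.mem_filter.1 u.2.2).1).2⟩

/-- The number of components of the factor of a subnetwork. -/
abbrev Block.width {S : FESystem T m} (u : S.Block) : ℕ := (S.kind u.1).comps d

/-- The affine piece which a subnetwork multiplies with the indicator of its cell. -/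
def piece (o : T.Orientation) (u : S.Block) : Eu d → Fin u.width → ℝ :=
  (S.kind u.1).shape o u.2.1.1 u.cell

/-- The sup norm on `D` of the affine piece. -/
def kappa (o : T.Orientation) (u : S.Block) : ℝ :=
  sSup ((fun x => ‖S.piece o u x‖) '' D)

/-- `1` or `-1`. -/
def sgn (b : Bool) : ℝ := if b then 1 else -1

/-- Weights of the first layer: the barycentric coordinates of the cell, and plus and minus the
components of the affine piece. -/
def A₁ (o : T.Orientation) :
    Matrix (Σ u : S.Block, (u.cell : Finset (Eu d)) ⊕ Fin u.width × Bool) (Fin d) ℝ :=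
  of fun r l => match r with
    | ⟨u, .inl a⟩ => T.bary u.cell a (EuclideanSpace.single l 1) - T.bary u.cell a 0
    | ⟨u, .inr (j, b)⟩ => sgn b * (S.piece o u (EuclideanSpace.single l 1) j - S.piece o u 0 j)

/-- Biases of the first layer. -/
def b₁ (o : T.Orientation) :
    (Σ u : S.Block, (u.cell : Finset (Eu d)) ⊕ Fin u.width × Bool) → ℝ :=
  fun r => match r with
    | ⟨u, .inl a⟩ => T.bary u.cell a 0
    | ⟨u, .inr (j, b)⟩ => sgn b * S.piece o u 0 j

/-- Weights of the second layer: all barycentric coordinates are positive (this emulates the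
indicator function of the interior of the cell); the affine piece is passed on. -/
def A₂ : Matrix (Σ u : S.Block, Unit ⊕ Fin u.width × Bool)
    (Σ u : S.Block, (u.cell : Finset (Eu d)) ⊕ Fin u.width × Bool) ℝ :=
  blockDiagonal' fun _ => fromBlocks (of fun _ _ => 1) 0 0 1

/-- Biases of the second layer. -/
def b₂ : (Σ u : S.Block, Unit ⊕ Fin u.width × Bool) → ℝ :=
  fun r => Sum.elim (fun _ => -((d : ℝ) + 1 - 1 / 4)) 0 r.2

/-- Weights of the third layer, which passes on plus and minus the value of the indicator function
and plus and minus the affine piece. -/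
def A₃ : Matrix (Σ u : S.Block, Bool ⊕ Fin u.width × Bool)
    (Σ u : S.Block, Unit ⊕ Fin u.width × Bool) ℝ :=
  blockDiagonal' fun _ => fromBlocks (of fun b _ => sgn b) 0 0
    (of fun p q => if p.1 = q.1 then sgn p.2 * sgn q.2 else 0)

/-- Weights of the fourth layer, which multiplies the affine piece `z` with the value `y` of the
indicator function, by `z y = relu (z - κ (1 - y)) - relu (-z - κ (1 - y))`. -/
def A₄ (o : T.Orientation) : Matrix (Σ u : S.Block, Fin u.width × Bool)
    (Σ u : S.Block, Bool ⊕ Fin u.width × Bool) ℝ :=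
  blockDiagonal' fun u => fromCols (of fun _ b => S.kappa o u * sgn b)
    (of fun p q => if p.1 = q.1 then sgn p.2 * sgn q.2 else 0)

/-- Biases of the fourth layer. -/
def b₄ (o : T.Orientation) : (Σ u : S.Block, Fin u.width × Bool) → ℝ :=
  fun r => -S.kappa o r.1

/-- Weights of the output layer: the only ones that depend on the coefficients. -/
def A₅ (coef : S.Dof → ℝ) : Matrix S.Comp (Σ u : S.Block, Fin u.width × Bool) ℝ :=
  of fun i r => if i = ⟨r.1.1, r.2.1⟩ then coef r.1.dof * sgn r.2.2 else 0

/-- The FoSLS network `Φ^{♦,v}` of the finite element function `v` with the given coefficients.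
It has depth five and the activation functions relu and bisu, and its hidden layers do not depend
on `v`. -/
def net (o : T.Orientation) (coef : S.Dof → ℝ) : NeuralNet (Fin d) S.Comp :=
  .hidden (S.A₁ o) (S.b₁ o) (fun r => Sum.elim (fun _ => bisu) (fun _ => relu) r.2) <|
  .hidden S.A₂ S.b₂ (fun r => Sum.elim (fun _ => bisu) (fun _ => relu) r.2) <|
  .hidden S.A₃ 0 (fun _ => relu) <|
  .hidden (S.A₄ o) (S.b₄ o) (fun _ => relu) <|
  .output (S.A₅ coef) 0

/-- The FoSLS network class `NN(♦; T, D)`. -/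
def NN (o : T.Orientation) : Set (NeuralNet (Fin d) S.Comp) := Set.range (S.net o)

/-- The finite element space as a subset of a space `V` of (classes of) functions on `D`. -/
def space {V : Type*} (J : V → (Eu d →ₘ[volume.restrict D] (S.Comp → ℝ))) : Set V :=
  {v | S.IsFE (J v)}

end FESystem

end

/-! The least squares part is short. Applied to `U - v`, the two-sided bound on `L` makes residual
and error equivalent, and it makes `L` injective. The realizations form a finite-dimensional
subspace `W` of `V`, so the residual is minimized by the preimage of the orthogonal projection of
`F` onto `L W`. Pythagoras gives uniqueness in `W`, and injectivity of the realization map carries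
it over to networks. Comparison with the best approximation of `U` in `W` gives quasi-optimality.

The substance is that networks correspond bijectively to finite element functions. The step units
compute the indicator of the interior of a cell exactly, and the relu units multiply it exactly with
an affine piece. Hence, inside each cell, the network is the local combination of shape functions
(`realize_net_of_mem_interior`). Cell boundaries are null sets and do not matter.

It remains to identify combinations of shape functions with the space defined by traces
(`isFE_iff`). This rests on the degrees of freedom: they determine a local function
(`IsLocal.eq_zero_of_dof`), they vanish on a common subsimplex exactly when the trace does
(`sameTrace_of_dof_eq_zero`, `dof_eq_zero_of_sameTrace`), and they are dual to the shape functions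
(`dof_shape`). Duality also recovers the coefficients from the realization
(`coef_eq_of_realize_ae_eq`). -/

/-- Affine maps that agree on a set that spans the whole space are equal. -/
theorem AffineMap.eq_of_eqOn_of_span_eq_top {E F : Type*} [AddCommGroup E] [Module ℝ E]
    [AddCommGroup F] [Module ℝ F] {A A' : E →ᵃ[ℝ] F} {s : Set E} (hs : affineSpan ℝ s = ⊤)
    (h : ∀ x ∈ s, A x = A' x) (x : E) : A x = A' x := by
  have h1 : (⊤ : AffineSubspace ℝ E) ≤ (AffineSubspace.comap (A - A')
      (AffineSubspace.mk' (0 : F) ⊥)) := by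
    rw [← hs, affineSpan_le]
    intro y hy
    simp [h y hy]
  have h2 := h1 (AffineSubspace.mem_top ℝ E x)
  simpa [sub_eq_zero] using h2

/-! ### Barycentric coordinates and the geometry of cells. -/

namespace RegularPartition

variable {d : ℕ} {D : Set (Eu d)} (T : RegularPartition D)

theorem range_basis (K : T.cells) :
    Set.range (T.basis K) = ((K : Finset (Eu d)) : Set (Eu d)) :=
  Subtype.range_coe

theorem span_cell (K : T.cells) : affineSpan ℝ ((K : Finset (Eu d)) : Set (Eu d)) = ⊤ := by
  rw [← T.range_basis K, (T.basis K).tot]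

/-- `bary` as an affine map. -/
noncomputable def baryMap (K : T.cells) (a : Eu d) : Eu d →ᵃ[ℝ] ℝ :=
  if h : a ∈ (K : Finset (Eu d)) then (T.basis K).coord ⟨a, h⟩ else 0

theorem baryMap_apply (K : T.cells) (a x : Eu d) : T.baryMap K a x = T.bary K a x := by
  unfold baryMap bary
  split_ifs <;> simp

theorem bary_vertex (K : T.cells) {a b : Eu d} (ha : a ∈ (K : Finset (Eu d)))
    (hb : b ∈ (K : Finset (Eu d))) : T.bary K a b = if a = b then 1 else 0 := by
  have h := (T.basis K).coord_apply ⟨a, ha⟩ ⟨b, hb⟩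
  have hb' : T.basis K ⟨b, hb⟩ = b := rfl
  rw [hb'] at h
  simp only [bary, ha, dif_pos, h]
  simp

theorem sum_bary (K : T.cells) (x : Eu d) : ∑ a : (K : Finset (Eu d)), T.bary K a x = 1 := by
  have := (T.basis K).sum_coord_apply_eq_one x
  simpa [bary] using this

theorem affine_eq_coord (A : Eu d →ᵃ[ℝ] ℝ) (x : Eu d) :
    A x = A 0 + ∑ l, (A (EuclideanSpace.single l 1) - A 0) * x l := by
  have hx : x = ∑ l, x l • EuclideanSpace.single l (1 : ℝ) := by
    ext i
    simp [Pi.single_apply]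
  have hl : ∀ y, A.linear y = A y - A 0 := fun y => by
    have := A.linearMap_vsub y 0
    simpa using this
  have h2 : A.linear x = ∑ l, (A (EuclideanSpace.single l 1) - A 0) * x l := by
    conv_lhs => rw [hx, map_sum]
    exact Finset.sum_congr rfl fun l _ => by rw [map_smul, hl, smul_eq_mul, mul_comm]
  rw [← h2, hl]
  ring

theorem bary_eq (K : T.cells) (a x : Eu d) :
    T.bary K a x = T.bary K a 0 + ∑ l, T.gradBary K a l * x l := by
  simpa [baryMap_apply, gradBary] using affine_eq_coord (T.baryMap K a) x

theorem gradBary_dot (K : T.cells) (a x y : Eu d) :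
    ∑ l, T.gradBary K a l * (x - y) l = T.bary K a x - T.bary K a y := by
  rw [T.bary_eq K a x, T.bary_eq K a y]
  simp [mul_sub]

theorem interior_hull (K : T.cells) :
    interior (convexHull ℝ ((K : Finset (Eu d)) : Set (Eu d))) =
      {x | ∀ a : (K : Finset (Eu d)), 0 < T.bary K a x} := by
  have := (T.basis K).interior_convexHull
  rw [T.range_basis] at this
  rw [this]
  simp [bary]

/-- Two vectors with the same products with all edge vectors of a cell that emanate from one
point are equal. -/
theorem eq_of_inner_eq (K : T.cells) {v w x : Eu d}
    (h : ∀ b ∈ (K : Finset (Eu d)), inner ℝ v (b - x) = inner ℝ w (b - x)) : v = w := by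
  have h1 : ∀ y, ((innerₗ (Eu d) v).toAffineMap - AffineMap.const ℝ (Eu d) (inner ℝ v x)) y =
      ((innerₗ (Eu d) w).toAffineMap - AffineMap.const ℝ (Eu d) (inner ℝ w x)) y :=
    AffineMap.eq_of_eqOn_of_span_eq_top (T.span_cell K) fun b hb => by
      simpa [inner_sub_right] using h b hb
  -- At this point the identity reads ⟨v, v - w⟩ = ⟨w, v - w⟩, that is, ‖v - w‖² = 0.
  have h2 := h1 (x + (v - w))
  simp only [AffineMap.coe_sub, Pi.sub_apply, LinearMap.coe_toAffineMap, innerₗ_apply_apply, AffineMap.const_apply,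
    inner_add_right, add_sub_cancel_left] at h2
  rw [← sub_eq_zero, ← inner_sub_left, inner_self_eq_zero, sub_eq_zero] at h2
  exact h2

/-- By regularity `x` lies in the hull of the common vertices. If a vertex `a` of `K` were missing
from `K'`, its barycentric coordinate would vanish on that hull, but it is positive in the interior
of `K`. Equal cardinalities turn the inclusion into equality. -/
theorem bary_pos_cell_unique {K K' : T.cells} {x : Eu d}
    (hx : x ∈ interior (convexHull ℝ ((K : Finset (Eu d)) : Set (Eu d))))
    (hx' : x ∈ convexHull ℝ ((K' : Finset (Eu d)) : Set (Eu d))) : K = K' := by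
  have h1 : x ∈ convexHull ℝ (((K : Finset (Eu d)) ∩ K' : Finset (Eu d)) : Set (Eu d)) := by
    rw [← T.regular K K.2 K' K'.2]
    exact ⟨interior_subset hx, hx'⟩
  rw [T.interior_hull] at hx
  have hsub : (K : Finset (Eu d)) ⊆ K' := by
    intro a ha
    by_contra hn
    have h2 : convexHull ℝ (((K : Finset (Eu d)) ∩ K' : Finset (Eu d)) : Set (Eu d)) ⊆
        T.baryMap K a ⁻¹' {0} := by
      refine convexHull_min ?_ ((convex_singleton (0 : ℝ)).affine_preimage _)
      intro b hb
      simp only [Finset.coe_inter, Set.mem_inter_iff, Finset.mem_coe] at hb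
      simp only [Set.mem_preimage, baryMap_apply, Set.mem_singleton_iff]
      rw [T.bary_vertex K ha hb.1, if_neg]
      rintro rfl
      exact hn hb.2
    have h3 := h2 h1
    simp only [Set.mem_preimage, baryMap_apply, Set.mem_singleton_iff] at h3
    exact (hx ⟨a, ha⟩).ne' h3
  exact Subtype.ext (Finset.eq_of_subset_of_card_le hsub
    (by rw [T.card_cell K K.2, T.card_cell K' K'.2]))

end RegularPartition

/-! ### The local polynomial spaces. -/

namespace FEKind
variable {d : ℕ}

/-- The common feature of the four kinds: it reduces every identity between local functions to the
vertices of a simplex. -/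
theorem IsLocal.exists_affine {k : FEKind} {p : Eu d → Fin (k.comps d) → ℝ} (hp : k.IsLocal p) :
    ∃ A : Eu d →ᵃ[ℝ] (Fin (k.comps d) → ℝ), ∀ x, A x = p x := by
  have key : ∀ (w : Fin (k.comps d) → ℝ) (g : Fin (k.comps d) → Eu d →ₗ[ℝ] ℝ),
      (∀ x j, p x j = w j + g j x) →
      ∃ A : Eu d →ᵃ[ℝ] (Fin (k.comps d) → ℝ), ∀ x, A x = p x := fun w g h =>
    ⟨(LinearMap.pi g).toAffineMap + AffineMap.const ℝ _ w, fun x => by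
      ext j; simp [h, add_comm]⟩
  cases k with
  | S1 => 
    obtain ⟨g, r, h⟩ := hp
    exact key (fun _ => r) (fun _ => g) fun x j => by rw [h, add_comm]
  | N0 => 
    obtain ⟨w, B, -, h⟩ := hp
    exact key w (fun j => ∑ l, B j l • (EuclideanSpace.proj (𝕜 := ℝ) l : Eu d →L[ℝ] ℝ).toLinearMap)
      fun x j => by simp [h, LinearMap.sum_apply]
  | RT0 => 
    obtain ⟨w, β, h⟩ := hp
    exact key w (fun j => β • (EuclideanSpace.proj (𝕜 := ℝ) j : Eu d →L[ℝ] ℝ).toLinearMap)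
      fun x j => by simp [h]
  | S0 => 
    obtain ⟨r, h⟩ := hp
    exact key (fun _ => r) (fun _ => 0) fun x j => by simp [h]

theorem IsLocal.lin {k : FEKind} {p q : Eu d → Fin (k.comps d) → ℝ} (hp : k.IsLocal p)
    (hq : k.IsLocal q) (c : ℝ) : k.IsLocal (p + c • q) := by
  cases k with
  | S1 =>
    obtain ⟨g, r, h⟩ := hp
    obtain ⟨g', r', h'⟩ := hq
    exact ⟨g + c • g', r + c * r', fun x j => by simp [h, h']; ring⟩
  | N0 =>
    obtain ⟨w, B, hB, h⟩ := hp
    obtain ⟨w', B', hB', h'⟩ := hq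
    refine ⟨w + c • w', B + c • B', by simp [hB, hB']; abel, fun x j => ?_⟩
    simp [h, h', add_mul, Finset.sum_add_distrib, mul_add, Finset.mul_sum, mul_assoc]; ring
  | RT0 =>
    obtain ⟨w, β, h⟩ := hp
    obtain ⟨w', β', h'⟩ := hq
    exact ⟨w + c • w', β + c * β', fun x j => by simp [h, h']; ring⟩
  | S0 =>
    obtain ⟨r, h⟩ := hp
    obtain ⟨r', h'⟩ := hq
    exact ⟨r + c * r', fun x j => by simp [h, h']⟩

theorem isLocal_zero (k : FEKind) : k.IsLocal (0 : Eu d → Fin (k.comps d) → ℝ) := by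
  cases k with
  | S1 => exact ⟨0, 0, by simp⟩
  | N0 => exact ⟨0, 0, by simp⟩
  | RT0 => exact ⟨0, 0, by simp⟩
  | S0 => exact ⟨0, by simp⟩

theorem IsLocal.sub {k : FEKind} {p q : Eu d → Fin (k.comps d) → ℝ} (hp : k.IsLocal p)
    (hq : k.IsLocal q) : k.IsLocal (p - q) := by
  simpa [sub_eq_add_neg] using hp.lin hq (-1)

theorem IsLocal.sum {k : FEKind} {ι : Type*} (s : Finset ι) (c : ι → ℝ)
    {p : ι → Eu d → Fin (k.comps d) → ℝ} (hp : ∀ i ∈ s, k.IsLocal (p i)) :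
    k.IsLocal (∑ i ∈ s, c i • p i) := by
  induction s using Finset.induction_on with
  | empty => simpa using k.isLocal_zero
  | insert i s hi ih =>
    rw [Finset.sum_insert hi, add_comm]
    exact (ih fun j hj => hp j (Finset.mem_insert_of_mem hj)).lin
      (hp i (Finset.mem_insert_self i s)) _

theorem sameTrace_iff_sub {k : FEKind} {s : Finset (Eu d)} {p q : Eu d → Fin (k.comps d) → ℝ} :
    k.SameTrace s p q ↔ k.SameTrace s (p - q) 0 := by
  cases k <;> simp [SameTrace, sub_mul, sub_eq_zero]

end FEKind

/-! ### Faces and their normals. -/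

theorem AffineMap.eq_of_mem_convexHull {E F : Type*} [AddCommGroup E] [Module ℝ E]
    [AddCommGroup F] [Module ℝ F] {A A' : E →ᵃ[ℝ] F} {s : Set E}
    (h : ∀ x ∈ s, A x = A' x) {x : E} (hx : x ∈ convexHull ℝ s) : A x = A' x := by
  have h1 : convexHull ℝ s ⊆ (A - A') ⁻¹' {0} :=
    convexHull_min (fun y hy => by simp [h y hy]) ((convex_singleton (0 : F)).affine_preimage _)
  simpa [sub_eq_zero] using h1 hx

theorem Eu.inner_eq_sum {d : ℕ} (v w : Eu d) : inner ℝ v w = ∑ j, v j * w j := by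
  simp [PiLp.inner_apply, mul_comm]

/-- A vector orthogonal to the differences of points of `s` is orthogonal to the simplex. -/
theorem Eu.inner_sub_eq_zero_of_mem_hull {d : ℕ} {s : Finset (Eu d)} {ν : Eu d}
    (hν : ∀ y ∈ s, ∀ z ∈ s, inner ℝ ν (y - z) = 0) {x y : Eu d}
    (hx : x ∈ convexHull ℝ (s : Set (Eu d))) (hy : y ∈ s) : inner ℝ ν (x - y) = 0 := by
  have := AffineMap.eq_of_mem_convexHull (A := (innerₗ (Eu d) ν).toAffineMap)
    (A' := AffineMap.const ℝ (Eu d) (inner ℝ ν y)) (s := (s : Set (Eu d)))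
    (fun z hz => by simpa [inner_sub_right, sub_eq_zero] using hν z hz y hy) hx
  simpa [inner_sub_right, sub_eq_zero] using this

/-- A point of a nonempty finite set. -/
noncomputable def Eu.basePt {d : ℕ} (s : Finset (Eu d)) : Eu d :=
  if h : s.Nonempty then h.choose else 0

theorem Eu.basePt_mem {d : ℕ} {s : Finset (Eu d)} (h : s.Nonempty) : Eu.basePt s ∈ s := by
  rw [Eu.basePt, dif_pos h]
  exact h.choose_spec

namespace RegularPartition

variable {d : ℕ} {D : Set (Eu d)} (T : RegularPartition D)

/-- The gradient of a barycentric coordinate as a vector. -/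
noncomputable def gradVec (K : T.cells) (a : Eu d) : Eu d := WithLp.toLp 2 (T.gradBary K a)

theorem inner_gradVec (K : T.cells) (a x y : Eu d) :
    inner ℝ (T.gradVec K a) (x - y) = T.bary K a x - T.bary K a y := by
  rw [Eu.inner_eq_sum, ← T.gradBary_dot]
  rfl

theorem bary_eq_zero_of_mem_hull (K : T.cells) {s : Finset (Eu d)} (hs : s ⊆ (K : Finset (Eu d)))
    {a x : Eu d} (ha : a ∈ (K : Finset (Eu d))) (has : a ∉ s)
    (hx : x ∈ convexHull ℝ (s : Set (Eu d))) : T.bary K a x = 0 := by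
  rw [← T.baryMap_apply]
  refine AffineMap.eq_of_mem_convexHull (A' := 0) (fun y hy => ?_) hx
  rw [T.baryMap_apply, T.bary_vertex K ha (hs hy), if_neg]
  · rfl
  · rintro rfl
    exact has hy

/-- Every normal of the face opposite to `a` is a multiple of the gradient of the barycentric
coordinate of `a`. -/
theorem normal_eq_smul_gradVec (K : T.cells) {s : Finset (Eu d)}
    (hs : s ⊆ (K : Finset (Eu d))) {a x ν : Eu d} (ha : a ∈ (K : Finset (Eu d))) (has : a ∉ s)
    (hK : ∀ b ∈ (K : Finset (Eu d)), b = a ∨ b ∈ s)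
    (hν : ∀ y ∈ s, ∀ z ∈ s, inner ℝ ν (y - z) = 0)
    (hx : x ∈ convexHull ℝ (s : Set (Eu d))) :
    ν = (-inner ℝ ν (x - a)) • T.gradVec K a := by
  -- Test with `b - x` for all vertices `b`: on the face both sides vanish, and at `b = a`, where
  -- the coordinate is one, the factor comes out.
  refine T.eq_of_inner_eq K (x := x) fun b hb => ?_
  rw [real_inner_smul_left, T.inner_gradVec, T.bary_eq_zero_of_mem_hull K hs ha has hx,
    T.bary_vertex K ha hb]
  rcases hK b hb with rfl | hbs
  · rw [← neg_sub x b, inner_neg_right]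
    simp
  · rw [← neg_sub x b, inner_neg_right, Eu.inner_sub_eq_zero_of_mem_hull hν hx hbs, if_neg]
    · simp
    · rintro rfl
      exact has hbs

theorem exists_opposite (K : T.cells) {s : Finset (Eu d)} (hs : s ⊆ (K : Finset (Eu d)))
    (hc : s.card = d) : ∃ a ∈ (K : Finset (Eu d)), a ∉ s ∧ (K : Finset (Eu d)) \ s = {a} ∧
      ∀ b ∈ (K : Finset (Eu d)), b = a ∨ b ∈ s := by
  have h1 : ((K : Finset (Eu d)) \ s).card = 1 := by
    rw [Finset.card_sdiff_of_subset hs, T.card_cell K K.2, hc]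
    omega
  obtain ⟨a, ha⟩ := Finset.card_eq_one.1 h1
  have h2 : a ∈ (K : Finset (Eu d)) \ s := by simp [ha]
  refine ⟨a, (Finset.mem_sdiff.1 h2).1, (Finset.mem_sdiff.1 h2).2, ha, fun b hb => ?_⟩
  by_cases hbs : b ∈ s
  · exact Or.inr hbs
  · left
    simpa [ha] using Finset.mem_sdiff.2 ⟨hb, hbs⟩

theorem mem_subsimplices {s : Finset (Eu d)} {j : ℕ} :
    s ∈ T.subsimplices j ↔ ∃ K : T.cells, s ⊆ (K : Finset (Eu d)) ∧ s.card = j := by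
  simp [subsimplices, Finset.mem_powersetCard]
  grind

end RegularPartition

/-! ### Degrees of freedom, traces and unisolvence. -/

namespace FEKind
variable {d : ℕ} {D : Set (Eu d)} {T : RegularPartition D} (o : T.Orientation)

/-- The degree of freedom of a subsimplex: the value at a vertex, the circulation along an edge,
the normal component on a face, the value on a cell. -/
noncomputable def dof : (k : FEKind) → Finset (Eu d) → (Eu d → Fin (k.comps d) → ℝ) → ℝ
  | S1, s, p => p (Eu.basePt s) 0
  | N0, s, p => ∑ b ∈ s.erase (o.tail s), ∑ j, p (o.tail s) j * (b - o.tail s) j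
  | RT0, s, p => ∑ j, p (Eu.basePt s) j * o.normal s j
  | S0, s, p => p (Eu.basePt s) 0

theorem dof_lin (k : FEKind) (s : Finset (Eu d)) (p q : Eu d → Fin (k.comps d) → ℝ) (c : ℝ) :
    k.dof o s (p + c • q) = k.dof o s p + c * k.dof o s q := by
  cases k <;>
    simp [dof, add_mul, Finset.sum_add_distrib, Finset.mul_sum, mul_assoc]

theorem dof_zero (k : FEKind) (s : Finset (Eu d)) : k.dof o s 0 = 0 := by
  cases k <;> simp [dof]

theorem dof_sub (k : FEKind) (s : Finset (Eu d)) (p q : Eu d → Fin (k.comps d) → ℝ) :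
    k.dof o s (p - q) = k.dof o s p - k.dof o s q := by
  have := k.dof_lin o s p q (-1)
  rw [neg_one_smul, ← sub_eq_add_neg] at this
  rw [this]; ring

theorem dof_sum (k : FEKind) (s : Finset (Eu d)) {ι : Type*} (I : Finset ι) (c : ι → ℝ)
    (p : ι → Eu d → Fin (k.comps d) → ℝ) :
    k.dof o s (∑ i ∈ I, c i • p i) = ∑ i ∈ I, c i * k.dof o s (p i) := by
  induction I using Finset.induction_on with
  | empty => simp [dof_zero]
  | insert i I hi ih =>
    rw [Finset.sum_insert hi, Finset.sum_insert hi, add_comm, dof_lin, ih, add_comm]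

theorem nverts_pos (hd : 0 < d) (k : FEKind) : 0 < k.nverts d := by
  cases k <;> simp [nverts, hd]

/-- An edge consists of its tail and its head. -/
theorem exists_head {e : Finset (Eu d)} (he : e ∈ T.subsimplices 2) :
    ∃ b ∈ e, b ≠ o.tail e ∧ e.erase (o.tail e) = {b} := by
  have hc : (e.erase (o.tail e)).card = 1 := by
    obtain ⟨K, -, hc⟩ := T.mem_subsimplices.1 he
    rw [Finset.card_erase_of_mem (o.tail_mem e he), hc]
  obtain ⟨b, hb⟩ := Finset.card_eq_one.1 hc
  have : b ∈ e.erase (o.tail e) := by simp [hb]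
  exact ⟨b, Finset.mem_of_mem_erase this, Finset.ne_of_mem_erase this, hb⟩

theorem IsLocal.exists_affine_dot {k : FEKind} {p : Eu d → Fin (k.comps d) → ℝ}
    (hp : k.IsLocal p) (v : Fin (k.comps d) → ℝ) :
    ∃ A : Eu d →ᵃ[ℝ] ℝ, ∀ x, A x = ∑ j, p x j * v j := by
  obtain ⟨A, hA⟩ := hp.exists_affine
  refine ⟨(∑ j, v j • LinearMap.proj (R := ℝ) (φ := fun _ => ℝ) j).toAffineMap.comp A,
    fun x => ?_⟩
  simp [hA, mul_comm]

/-- A vanishing trace makes the degrees of freedom vanish. -/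
theorem dof_eq_zero_of_sameTrace (hd : 0 < d) {k : FEKind} {s t : Finset (Eu d)} {K : T.cells}
    (hst : s ⊆ t) (htK : t ⊆ (K : Finset (Eu d))) (hs : s.card = k.nverts d)
    (ht : s = t ∨ t.card ≤ d) {p : Eu d → Fin (k.comps d) → ℝ} (h : k.SameTrace t p 0) :
    k.dof o s p = 0 := by
  have hne : s.Nonempty := Finset.card_pos.1 (hs ▸ k.nverts_pos hd)
  have hmem : s ∈ T.subsimplices (k.nverts d) := T.mem_subsimplices.2 ⟨K, hst.trans htK, hs⟩
  have hhull : ∀ x ∈ s, x ∈ convexHull ℝ (t : Set (Eu d)) := fun x hx =>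
    subset_convexHull ℝ _ (hst hx)
  cases k with
  | S1 => exact congrFun (h _ (hhull _ (Eu.basePt_mem hne))) 0
  | N0 =>
    refine Finset.sum_eq_zero fun b hb => ?_
    have hta := o.tail_mem s hmem
    simpa using h _ (hhull _ hta) b (hst (Finset.mem_of_mem_erase hb)) _ (hst hta)
  | RT0 =>
    -- On a whole cell the `RT0` trace condition is void, since only `ν = 0` is orthogonal to all
    -- edges. The hypothesis `ht` excludes that case and leaves the face itself.
    have hst' : s = t := ht.elim id fun ht => Finset.eq_of_subset_of_card_le hst (by
      simpa [hs, nverts] using ht)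
    subst hst'
    have := h _ (hhull _ (Eu.basePt_mem hne)) (o.normal s) (o.normal_orth s hmem)
    rw [dof, this]
    simp
  | S0 => exact congrFun (h _ (hhull _ (Eu.basePt_mem hne))) 0

/-- Vanishing degrees of freedom make the trace vanish. -/
theorem sameTrace_of_dof_eq_zero (hd : 0 < d) {k : FEKind} {t : Finset (Eu d)} {K : T.cells}
    (htK : t ⊆ (K : Finset (Eu d))) (ht : k.nverts d ≤ t.card)
    {p : Eu d → Fin (k.comps d) → ℝ} (hp : k.IsLocal p)
    (h : ∀ s ⊆ t, s.card = k.nverts d → k.dof o s p = 0) : k.SameTrace t p 0 := by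
  have htd : t.card ≤ d + 1 := by
    rw [← T.card_cell K K.2]
    exact Finset.card_le_card htK
  cases k with
  | S1 =>
    intro x hx
    obtain ⟨A, hA⟩ := hp.exists_affine
    rw [← hA]
    refine AffineMap.eq_of_mem_convexHull (A' := 0) (fun a ha => ?_) hx
    have h1 := h {a} (by simpa using ha) (by simp [nverts])
    have h2 : Eu.basePt {a} = a := by simpa using Eu.basePt_mem (Finset.singleton_nonempty a)
    rw [hA]
    funext j
    rw [dof, h2] at h1
    rw [Subsingleton.elim j 0, h1]
    rfl
  | N0 =>
    obtain ⟨w, B, hB, hpB⟩ := id hp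
    -- A skew `B` gives (b - a)ᵀB(b - a) = 0, so the tangential component is constant along an edge.
    -- The circulation therefore only changes sign with the orientation, and the choice of tail is
    -- harmless.
    have hskew : ∀ a b : Eu d, ∑ j, p a j * (b - a) j = -∑ j, p b j * (a - b) j := by
      intro a b
      have h0 : ∑ j, (∑ l, B j l * (b - a) l) * (b - a) j = 0 := by
        have h1 : ∑ j, (∑ l, B j l * (b - a) l) * (b - a) j =
            ∑ j, (∑ l, B l j * (b - a) l) * (b - a) j := by
          simp only [Finset.sum_mul]
          rw [Finset.sum_comm]
          exact Finset.sum_congr rfl fun _ _ => Finset.sum_congr rfl fun _ _ => by ring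
        have h2 : ∀ j l, B l j = -B j l := fun j l => congrFun (congrFun hB j) l
        have h3 : ∑ j, (∑ l, B l j * (b - a) l) * (b - a) j =
            -∑ j, (∑ l, B j l * (b - a) l) * (b - a) j := by
          rw [← Finset.sum_neg_distrib]
          refine Finset.sum_congr rfl fun j _ => ?_
          rw [← neg_mul, ← Finset.sum_neg_distrib]
          exact congrArg (· * _) (Finset.sum_congr rfl fun l _ => by rw [h2, neg_mul])
        linarith
      rw [← sub_eq_zero, sub_neg_eq_add, ← Finset.sum_add_distrib, ← neg_eq_zero, ← h0,
        ← Finset.sum_neg_distrib]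
      refine Finset.sum_congr rfl fun j _ => ?_
      simp only [hpB, PiLp.sub_apply, mul_sub, Finset.sum_sub_distrib]
      ring
    have hedge : ∀ a ∈ t, ∀ b ∈ t, ∑ j, p a j * (b - a) j = 0 := by
      intro a ha b hb
      by_cases hab : a = b
      · simp [hab]
      have hsub : ({a, b} : Finset (Eu d)) ⊆ t := by
        intro x hx
        rcases Finset.mem_insert.1 hx with rfl | hx
        · exact ha
        · exact Finset.mem_singleton.1 hx ▸ hb
      have hcard : ({a, b} : Finset (Eu d)).card = 2 := Finset.card_pair hab
      have h1 := h _ hsub hcard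
      have htail := o.tail_mem _ (T.mem_subsimplices.2 ⟨K, hsub.trans htK, hcard⟩)
      rw [dof] at h1
      rcases Finset.mem_insert.1 htail with e | e
      · rw [e] at h1
        simpa [hab] using h1
      · rw [Finset.mem_singleton] at e
        rw [e] at h1
        have h2 : ({a, b} : Finset (Eu d)).erase b = {a} := by
          ext x; simp; grind
        rw [h2, Finset.sum_singleton] at h1
        rw [hskew, h1, neg_zero]
    intro x hx y hy z hz
    obtain ⟨A, hA⟩ := hp.exists_affine_dot (fun j => (y - z) j)
    rw [← hA]
    -- For fixed `y`, `z` the tangential component is affine in `x`. At a vertex `c` it splits along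
    -- the edges by y - z = (y - c) - (z - c).
    have h0 : ∀ c ∈ (t : Set (Eu d)), A c = (0 : Eu d →ᵃ[ℝ] ℝ) c := by
      intro c hc
      have h1 := hedge c hc y hy
      have h2 := hedge c hc z hz
      have h3 : ∀ j, p c j * (y - z) j = p c j * (y - c) j - p c j * (z - c) j := fun j => by
        simp only [PiLp.sub_apply]; ring
      rw [hA, Finset.sum_congr rfl fun j _ => h3 j, Finset.sum_sub_distrib, h1, h2]
      simp
    rw [AffineMap.eq_of_mem_convexHull h0 hx]
    simp
  | RT0 =>
    intro x hx ν hν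
    have ht' : d ≤ t.card := ht
    rcases Nat.lt_or_ge d t.card with hlt | hge
    · have htK' : t = K := Finset.eq_of_subset_of_card_le htK (by
        rw [T.card_cell K K.2]; omega)
      have : ν = 0 := T.eq_of_inner_eq K (x := x) fun b hb => by
        rw [← neg_sub x b, inner_neg_right,
          Eu.inner_sub_eq_zero_of_mem_hull hν hx (htK' ▸ hb)]
        simp
      simp [this]
    · have htc : t.card = d := le_antisymm hge ht'
      obtain ⟨a, ha, hat, -, hK⟩ := T.exists_opposite K htK htc
      have hmem : t ∈ T.subsimplices d := T.mem_subsimplices.2 ⟨K, htK, htc⟩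
      have hne : t.Nonempty := Finset.card_pos.1 (by omega)
      have e1 := T.normal_eq_smul_gradVec K htK ha hat hK hν hx
      have e2 := T.normal_eq_smul_gradVec K htK ha hat hK (o.normal_orth t hmem) hx
      set α := inner ℝ (o.normal t) (x - a)
      have hα : α ≠ 0 := fun h0 => by
        have := o.norm_normal t hmem
        rw [e2, h0] at this
        simp at this
      -- Both normals are multiples of the same gradient, and the unit normal is a nonzero multiple.
      have e3 : ν = (inner ℝ ν (x - a) / α) • o.normal t := by
        conv_lhs => rw [e1]
        conv_rhs => rw [e2]
        rw [smul_smul]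
        congr 1
        field_simp
      obtain ⟨w, β, hpw⟩ := hp
      have h1 := h t subset_rfl htc
      have h2 := Eu.inner_sub_eq_zero_of_mem_hull (o.normal_orth t hmem) hx (Eu.basePt_mem hne)
      rw [Eu.inner_eq_sum] at h2
      rw [dof] at h1
      -- The normal component is constant on the face, as `β (x - basePt t)` is tangential to it.
      have h3 : ∑ j, p x j * o.normal t j = 0 := by
        have : ∑ j, p x j * o.normal t j = ∑ j, p (Eu.basePt t) j * o.normal t j +
            β * ∑ j, o.normal t j * (x - Eu.basePt t) j := by
          rw [Finset.mul_sum, ← Finset.sum_add_distrib]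
          refine Finset.sum_congr rfl fun j _ => ?_
          simp only [hpw, PiLp.sub_apply]
          ring
        rw [this, h1, h2]
        simp
      have h4 : ∑ j, p x j * ν j = inner ℝ ν (x - a) / α * ∑ j, p x j * o.normal t j := by
        rw [Finset.mul_sum]
        refine Finset.sum_congr rfl fun j _ => ?_
        conv_lhs => rw [e3, PiLp.smul_apply, smul_eq_mul, mul_left_comm]
      rw [h4, h3]
      simp
  | S0 =>
    intro x _
    have h1 := h t subset_rfl (le_antisymm htd ht)
    obtain ⟨r, hr⟩ := hp
    funext j
    rw [dof, hr] at h1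
    rw [hr, h1]
    rfl

/-- A local function is determined by its values at the vertices of a cell. -/
theorem IsLocal.eq_zero_of_vertices {k : FEKind} {K : T.cells}
    {p : Eu d → Fin (k.comps d) → ℝ} (hp : k.IsLocal p)
    (h : ∀ a ∈ (K : Finset (Eu d)), p a = 0) : p = 0 := by
  obtain ⟨A, hA⟩ := hp.exists_affine
  funext x
  rw [← hA, AffineMap.eq_of_eqOn_of_span_eq_top (A' := 0) (T.span_cell K)
    (fun a ha => by rw [hA, h a ha]; rfl) x]
  rfl

/-- Unisolvence of the degrees of freedom. -/
theorem IsLocal.eq_zero_of_dof (hd : 0 < d) {k : FEKind} {K : T.cells}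
    {p : Eu d → Fin (k.comps d) → ℝ} (hp : k.IsLocal p)
    (h : ∀ s ⊆ (K : Finset (Eu d)), s.card = k.nverts d → k.dof o s p = 0) : p = 0 := by
  have hnv : k.nverts d ≤ (K : Finset (Eu d)).card := by
    rw [T.card_cell K K.2]
    cases k <;> simp [nverts]; omega
  have htr := sameTrace_of_dof_eq_zero o hd subset_rfl hnv hp h
  refine hp.eq_zero_of_vertices (K := K) fun c hc => ?_
  have hcK : c ∈ convexHull ℝ ((K : Finset (Eu d)) : Set (Eu d)) := subset_convexHull ℝ _ hc
  cases k with
  | S1 => exact htr c hcK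
  | S0 => exact htr c hcK
  | N0 =>
    have h1 : WithLp.toLp 2 (p c) = (0 : Eu d) := T.eq_of_inner_eq K (x := c) fun b hb => by
      rw [Eu.inner_eq_sum]
      simpa using htr c hcK b hb c hc
    simpa using h1
  | RT0 =>
    -- Every face opposite to a vertex `a ≠ c` contains `c`, and its normal direction is the
    -- gradient of the coordinate of `a`.
    have h1 : ∀ a ∈ (K : Finset (Eu d)), a ≠ c →
        inner ℝ (T.gradVec K a) (WithLp.toLp 2 (p c)) = 0 := by
      intro a ha hac
      have hcard : ((K : Finset (Eu d)).erase a).card = d := by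
        rw [Finset.card_erase_of_mem ha, T.card_cell K K.2]; simp
      have h2 := sameTrace_of_dof_eq_zero o hd (k := RT0) (K := K) (Finset.erase_subset a K) hcard.ge hp
        (fun s hs => h s (hs.trans (Finset.erase_subset a K))) c
        (subset_convexHull ℝ _ (by simpa using ⟨hc, hac.symm⟩)) (T.gradVec K a) (by
          intro y hy z hz
          rw [T.inner_gradVec, T.bary_vertex K ha (Finset.mem_of_mem_erase hy),
            T.bary_vertex K ha (Finset.mem_of_mem_erase hz),
            if_neg (Finset.ne_of_mem_erase hy).symm, if_neg (Finset.ne_of_mem_erase hz).symm,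
            sub_zero])
      rw [Eu.inner_eq_sum]
      simpa [mul_comm] using h2
    have h2 : ∀ a ∈ (K : Finset (Eu d)), a ≠ c →
        T.bary K a (WithLp.toLp 2 (p c) + c) = T.bary K a c := by
      intro a ha hac
      have := T.inner_gradVec K a (WithLp.toLp 2 (p c) + c) c
      rw [add_sub_cancel_right, h1 a ha hac] at this
      linarith
    -- Moving from `c` by `p c` preserves all other coordinates, hence also this one, because they
    -- sum to one. The displacement must be zero.
    have h3 : T.bary K c (WithLp.toLp 2 (p c) + c) = T.bary K c c := by
      have e1 := T.sum_bary K (WithLp.toLp 2 (p c) + c)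
      have e2 := T.sum_bary K c
      rw [← Finset.add_sum_erase _ _ (Finset.mem_univ (⟨c, hc⟩ : (K : Finset (Eu d))))] at e1 e2
      have e3 : ∀ a ∈ Finset.univ.erase (⟨c, hc⟩ : (K : Finset (Eu d))),
          T.bary K a (WithLp.toLp 2 (p c) + c) = T.bary K a c := fun a ha =>
        h2 a a.2 fun e => Finset.ne_of_mem_erase ha (Subtype.ext e)
      rw [Finset.sum_congr rfl e3] at e1
      simp only at e1 e2
      linarith
    have h4 : WithLp.toLp 2 (p c) + c = c := by
      refine (T.basis K).ext_elem fun a => ?_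
      have : T.bary K a (WithLp.toLp 2 (p c) + c) = T.bary K a c := by
        by_cases hac : (a : Eu d) = c
        · rw [hac, h3]
        · exact h2 a a.2 hac
      simpa [RegularPartition.bary] using this
    simpa using h4

end FEKind

/-! ### Shape functions and their duality to the degrees of freedom. -/

namespace FEKind
variable {d : ℕ} {D : Set (Eu d)} {T : RegularPartition D} (o : T.Orientation)

theorem shape_isLocal (k : FEKind) (s : Finset (Eu d)) (K : T.cells) :
    k.IsLocal (k.shape o s K) := by
  cases k with
  | S1 =>
    refine ⟨∑ a ∈ s, (T.baryMap K a).linear, ∑ a ∈ s, T.bary K a 0, fun x j => ?_⟩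
    rw [shape, LinearMap.sum_apply, ← Finset.sum_add_distrib]
    refine Finset.sum_congr rfl fun a _ => ?_
    have := (T.baryMap K a).linearMap_vsub x 0
    simp only [vsub_eq_sub, sub_zero, T.baryMap_apply] at this
    rw [this]
    ring
  | N0 =>
    refine ⟨fun j => ∑ b ∈ s.erase (o.tail s), (T.bary K (o.tail s) 0 * T.gradBary K b j -
        T.bary K b 0 * T.gradBary K (o.tail s) j),
      of fun j l => ∑ b ∈ s.erase (o.tail s), (T.gradBary K (o.tail s) l * T.gradBary K b j -
        T.gradBary K b l * T.gradBary K (o.tail s) j), ?_, fun x j => ?_⟩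
    · ext j l
      simp only [transpose_apply, of_apply, Matrix.neg_apply, ← Finset.sum_neg_distrib]
      exact Finset.sum_congr rfl fun b _ => by ring
    · simp only [shape, of_apply, Finset.sum_mul]
      rw [Finset.sum_comm, ← Finset.sum_add_distrib]
      refine Finset.sum_congr rfl fun b _ => ?_
      rw [T.bary_eq K _ x, T.bary_eq K b x, add_mul, add_mul, Finset.sum_mul, Finset.sum_mul,
        add_sub_add_comm, ← Finset.sum_sub_distrib]
      exact congrArg _ (Finset.sum_congr rfl fun l _ => by ring)
  | RT0 =>
    refine ⟨fun j => ∑ a ∈ (K : Finset (Eu d)) \ s,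
        (-∑ l, o.normal s l * T.gradBary K a l) * (-a j),
      ∑ a ∈ (K : Finset (Eu d)) \ s, (-∑ l, o.normal s l * T.gradBary K a l), fun x j => ?_⟩
    rw [shape, Finset.sum_mul, ← Finset.sum_add_distrib]
    exact Finset.sum_congr rfl fun a _ => by ring
  | S0 => exact ⟨1, fun _ _ => rfl⟩

/-- The shape functions are dual to the degrees of freedom. -/
theorem dof_shape (hd : 0 < d) {k : FEKind} {s s' : Finset (Eu d)} {K : T.cells}
    (hsK : s ⊆ (K : Finset (Eu d))) (hs : s.card = k.nverts d)
    (hsK' : s' ⊆ (K : Finset (Eu d))) (hs' : s'.card = k.nverts d) :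
    k.dof o s' (k.shape o s K) = if s = s' then 1 else 0 := by
  have hmem : s ∈ T.subsimplices (k.nverts d) := T.mem_subsimplices.2 ⟨K, hsK, hs⟩
  have hmem' : s' ∈ T.subsimplices (k.nverts d) := T.mem_subsimplices.2 ⟨K, hsK', hs'⟩
  have hne' : s'.Nonempty := Finset.card_pos.1 (hs' ▸ k.nverts_pos hd)
  cases k with
  | S1 =>
    obtain ⟨a, rfl⟩ := Finset.card_eq_one.1 hs
    obtain ⟨b, rfl⟩ := Finset.card_eq_one.1 hs'
    have hb : Eu.basePt {b} = b := by simpa using Eu.basePt_mem (Finset.singleton_nonempty b)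
    rw [dof, shape, Finset.sum_singleton, hb, T.bary_vertex K (by simpa using hsK)
      (by simpa using hsK')]
    simp
  | N0 =>
    obtain ⟨b, hb, hbt, he⟩ := exists_head o hmem
    obtain ⟨b', hb', hbt', he'⟩ := exists_head o hmem'
    have ht := o.tail_mem s hmem
    have ht' := o.tail_mem s' hmem'
    -- The circulation is a 2 × 2 determinant of barycentric coordinates at tail and head of `s'`;
    -- it is nonzero only if the two edges have the same vertices.
    have e1 : N0.dof o s' (N0.shape o s K) =
        T.bary K (o.tail s) (o.tail s') * T.bary K b b' -
        T.bary K b (o.tail s') * T.bary K (o.tail s) b' := by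
      simp only [dof, shape, he, he', Finset.sum_singleton, sub_mul, Finset.sum_sub_distrib,
        mul_assoc, ← Finset.mul_sum]
      rw [T.gradBary_dot, T.gradBary_dot]
      ring
    rw [e1, T.bary_vertex K (hsK ht) (hsK' ht'), T.bary_vertex K (hsK hb) (hsK' hb'),
      T.bary_vertex K (hsK hb) (hsK' ht'), T.bary_vertex K (hsK ht) (hsK' hb')]
    have hse : s = {o.tail s, b} := (Finset.insert_erase ht).symm.trans (by rw [he])
    have hse' : s' = {o.tail s', b'} := (Finset.insert_erase ht').symm.trans (by rw [he'])
    by_cases h : s = s'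
    · subst h
      have : b = b' := by simpa using he.symm.trans he'
      subst this
      simp [hbt]
    · rw [if_neg h]
      by_cases h1 : o.tail s = o.tail s' ∧ b = b'
      · exact absurd (by rw [hse, hse', h1.1, h1.2]) h
      by_cases h2 : b = o.tail s' ∧ o.tail s = b'
      · exact absurd (by rw [hse, hse', h2.1, h2.2, Finset.pair_comm]) h
      grind
  | RT0 =>
    obtain ⟨a, ha, has, hKs, hK⟩ := T.exists_opposite K hsK hs
    have e1 : RT0.dof o s' (RT0.shape o s K) = -inner ℝ (o.normal s) (T.gradVec K a) *
        inner ℝ (o.normal s') (Eu.basePt s' - a) := by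
      simp only [dof, shape, hKs, Finset.sum_singleton, Eu.inner_eq_sum, mul_assoc,
        ← Finset.mul_sum, RegularPartition.gradVec, PiLp.sub_apply]
      congr 1
      exact Finset.sum_congr rfl fun j _ => by ring
    rw [e1]
    by_cases h : s = s'
    · subst h
      -- Writing one factor of ‖normal‖² = 1 as a multiple of the gradient gives exactly the
      -- required product.
      have e2 := T.normal_eq_smul_gradVec K hsK ha has hK (o.normal_orth s hmem)
        (subset_convexHull ℝ _ (Eu.basePt_mem hne'))
      have e3 := real_inner_self_eq_norm_sq (o.normal s)
      rw [o.norm_normal s hmem] at e3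
      nth_rewrite 2 [e2] at e3
      rw [real_inner_smul_right] at e3
      rw [if_pos rfl]
      linarith
    · rw [if_neg h, o.normal_orth s' hmem' _ (Eu.basePt_mem hne'), mul_zero]
      -- If the vertex `a` opposite to `s` were not in `s'`, then `s'` would be contained in `s`. So
      -- `a` is in `s'`, and `basePt s' - a` is tangential to `s'`.
      by_contra has'
      refine h (Finset.eq_of_subset_of_card_le (fun b hb => ?_) (by rw [hs, hs'])).symm
      refine (hK b (hsK' hb)).resolve_left ?_
      rintro rfl
      exact has' hb
  | S0 =>
    have h : ∀ t : Finset (Eu d), t ⊆ (K : Finset (Eu d)) → t.card = S0.nverts d → t = K :=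
      fun t ht hc => Finset.eq_of_subset_of_card_le ht (by rw [T.card_cell K K.2, hc]; rfl)
    rw [if_pos ((h s hsK hs).trans (h s' hsK' hs').symm)]
    rfl

/-- The degrees of freedom on a common subsimplex are determined by the trace. -/
theorem dof_eq_of_sameTrace (hd : 0 < d) {k : FEKind} {s : Finset (Eu d)} {K K' : T.cells}
    (hs : s.card = k.nverts d) (hsK : s ⊆ (K : Finset (Eu d))) (hsK' : s ⊆ (K' : Finset (Eu d)))
    {p p' : Eu d → Fin (k.comps d) → ℝ} (hKK : K = K' → p = p')
    (h : k.SameTrace (K ∩ K') p p') : k.dof o s p = k.dof o s p' := by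
  -- Distinct cells share at most `d` vertices, so a trace on the intersection controls the degrees
  -- of freedom. For equal cells it need not (`RT0`), and `hKK` is used instead.
  by_cases hK : K = K'
  · rw [hKK hK]
  · have hlt : ((K : Finset (Eu d)) ∩ K').card ≤ d := by
      by_contra hgt
      push Not at hgt
      have e : ∀ K'' : T.cells, (K : Finset (Eu d)) ∩ K' ⊆ K'' → (K : Finset (Eu d)) ∩ K' = K'' :=
        fun K'' hsub => Finset.eq_of_subset_of_card_le hsub (by rw [T.card_cell K'' K''.2]; omega)
      exact hK (Subtype.ext ((e K Finset.inter_subset_left).symm.trans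
        (e K' Finset.inter_subset_right)))
    rw [← sub_eq_zero, ← dof_sub]
    exact dof_eq_zero_of_sameTrace o hd (Finset.subset_inter hsK hsK') Finset.inter_subset_left hs
      (Or.inr hlt) (sameTrace_iff_sub.1 h)

theorem sameTrace_of_dof_eq (hd : 0 < d) {k : FEKind} {t : Finset (Eu d)} {K : T.cells}
    (htK : t ⊆ (K : Finset (Eu d))) (ht : k.nverts d ≤ t.card)
    {p q : Eu d → Fin (k.comps d) → ℝ} (hp : k.IsLocal p) (hq : k.IsLocal q)
    (h : ∀ s ⊆ t, s.card = k.nverts d → k.dof o s p = k.dof o s q) : k.SameTrace t p q :=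
  sameTrace_iff_sub.2 <| sameTrace_of_dof_eq_zero o hd htK ht (hp.sub hq) fun s hs hc => by
    rw [dof_sub, h s hs hc, sub_self]

theorem IsLocal.eq_of_dof (hd : 0 < d) {k : FEKind} {K : T.cells}
    {p q : Eu d → Fin (k.comps d) → ℝ} (hp : k.IsLocal p) (hq : k.IsLocal q)
    (h : ∀ s ⊆ (K : Finset (Eu d)), s.card = k.nverts d → k.dof o s p = k.dof o s q) : p = q :=
  sub_eq_zero.1 <| (hp.sub hq).eq_zero_of_dof o hd fun s hs hc => by
    rw [dof_sub, h s hs hc, sub_self]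

end FEKind

/-! ### The product space as the span of the shape functions. -/

namespace FESystem

variable {d : ℕ} {D : Set (Eu d)} {T : RegularPartition D} {m : ℕ} (S : FESystem T m)
  (o : T.Orientation)

/-- The restriction to a cell of the finite element function with the given coefficients. -/
noncomputable def localFun (coef : S.Dof → ℝ) (k : Fin m) (K : T.cells) :
    Eu d → Fin ((S.kind k).comps d) → ℝ :=
  ∑ s : S.index k with s.1 ⊆ (K : Finset (Eu d)), coef ⟨k, s⟩ • (S.kind k).shape o s K

theorem card_of_mem_index {k : Fin m} {s : Finset (Eu d)} (hs : s ∈ S.index k) :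
    s.card = (S.kind k).nverts d := by
  obtain ⟨K, -, hc⟩ := T.mem_subsimplices.1 (S.index_subset k hs)
  exact hc

theorem localFun_isLocal (coef : S.Dof → ℝ) (k : Fin m) (K : T.cells) :
    (S.kind k).IsLocal (S.localFun o coef k K) :=
  FEKind.IsLocal.sum _ _ fun _ _ => FEKind.shape_isLocal o _ _ _

/-- By duality. The value does not depend on `K`: neighbouring pieces share their degrees of
freedom, hence their traces, and those outside the index set vanish. -/
theorem dof_localFun (hd : 0 < d) (coef : S.Dof → ℝ) {k : Fin m} {K : T.cells}
    {s : Finset (Eu d)} (hs : s ⊆ (K : Finset (Eu d))) (hc : s.card = (S.kind k).nverts d) :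
    (S.kind k).dof o s (S.localFun o coef k K) =
      if h : s ∈ S.index k then coef ⟨k, s, h⟩ else 0 := by
  rw [localFun, FEKind.dof_sum]
  have e : ∀ t ∈ (Finset.univ.filter fun t : S.index k => t.1 ⊆ (K : Finset (Eu d))),
      coef ⟨k, t⟩ * (S.kind k).dof o s ((S.kind k).shape o t K) =
        coef ⟨k, t⟩ * if t.1 = s then 1 else 0 := fun t ht => by
    rw [FEKind.dof_shape o hd (Finset.mem_filter.1 ht).2 (S.card_of_mem_index t.2) hs hc]
  rw [Finset.sum_congr rfl e]
  split_ifs with h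
  · rw [Finset.sum_eq_single_of_mem ⟨s, h⟩ (by simpa using hs)]
    · simp
    · rintro ⟨t, ht⟩ - hne
      rw [if_neg, mul_zero]
      rintro rfl
      exact hne rfl
  · refine Finset.sum_eq_zero fun t _ => ?_
    rw [if_neg, mul_zero]
    rintro rfl
    exact h t.2

/-- The finite element functions are the combinations of the shape functions. -/
theorem isFE_iff (hd : 0 < d) (f : Eu d → S.Comp → ℝ) :
    S.IsFE f ↔ ∃ coef : S.Dof → ℝ, ∀ᵐ x ∂volume.restrict D, ∀ K : T.cells,
      x ∈ convexHull ℝ ((K : Finset (Eu d)) : Set (Eu d)) →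
        ∀ (k : Fin m) j, f x ⟨k, j⟩ = S.localFun o coef k K x j := by
  constructor
  · intro h
    choose p hloc htr hzero hae using h
    choose Kof hKof using fun i : S.Dof =>
      T.mem_subsimplices.1 (S.index_subset i.1 i.2.2)
    -- Each coefficient is read off on one arbitrarily chosen cell; equality of traces makes the
    -- choice immaterial.
    refine ⟨fun i => (S.kind i.1).dof o i.2 (p i.1 (Kof i)), ?_⟩
    have key : ∀ (k : Fin m) (K : T.cells), p k K = S.localFun o
        (fun i => (S.kind i.1).dof o i.2 (p i.1 (Kof i))) k K := by
      intro k K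
      refine (hloc k K K.2).eq_of_dof o hd (K := K) (S.localFun_isLocal o _ k K) fun s hs hc => ?_
      rw [S.dof_localFun o hd _ hs hc]
      split_ifs with hi
      · have hK := (hKof ⟨k, s, hi⟩).1
        refine FEKind.dof_eq_of_sameTrace o hd hc hs hK (fun e => by rw [← e])
          (htr k K K.2 _ (Kof ⟨k, s, hi⟩).2 ?_)
        rw [← hc]
        exact Finset.card_le_card (Finset.subset_inter hs hK)
      · exact FEKind.dof_eq_zero_of_sameTrace o hd subset_rfl hs hc (Or.inl rfl)
          (hzero k s (T.mem_subsimplices.2 ⟨K, hs, hc⟩) hi K K.2 hs)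
    filter_upwards [ae_all_iff.2 hae] with x hx K hK k j
    rw [hx k K K.2 hK j, key]
  · rintro ⟨coef, hae⟩ k
    have hloc := S.localFun_isLocal o coef k
    refine ⟨fun K => if h : K ∈ T.cells then S.localFun o coef k ⟨K, h⟩ else 0, ?_, ?_, ?_, ?_⟩
    · intro K hK
      simpa [hK] using hloc ⟨K, hK⟩
    · intro K hK K' hK' hc
      simp only [hK, hK', dif_pos]
      refine FEKind.sameTrace_of_dof_eq o hd (K := ⟨K, hK⟩) Finset.inter_subset_left hc
        (hloc _) (hloc _) fun s hs hsc => ?_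
      rw [S.dof_localFun o hd coef (K := ⟨K, hK⟩) (hs.trans Finset.inter_subset_left) hsc,
        S.dof_localFun o hd coef (K := ⟨K', hK'⟩) (hs.trans Finset.inter_subset_right) hsc]
    · intro s hs hsi K hK hsK
      simp only [hK, dif_pos]
      obtain ⟨-, -, hsc⟩ := T.mem_subsimplices.1 hs
      refine FEKind.sameTrace_of_dof_eq_zero o hd (K := ⟨K, hK⟩) hsK hsc.ge (hloc _)
        fun t ht htc => ?_
      have : t = s := Finset.eq_of_subset_of_card_le ht (by rw [hsc, htc])
      subst this
      rw [S.dof_localFun o hd coef (K := ⟨K, hK⟩) hsK hsc, dif_neg hsi]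
    · filter_upwards [hae] with x hx K hK hxK j
      simp only [hK, dif_pos]
      exact hx ⟨K, hK⟩ hxK k j

end FESystem

/-! ### Elementary network gates. -/

theorem Matrix.blockDiagonal'_mulVec_apply {o : Type*} {m' n' : o → Type*} [Fintype o]
    [DecidableEq o] [∀ i, Fintype (n' i)] (M : ∀ i, Matrix (m' i) (n' i) ℝ)
    (v : (Σ i, n' i) → ℝ) (r : Σ i, m' i) :
    (blockDiagonal' M *ᵥ v) r = (M r.1 *ᵥ fun j => v ⟨r.1, j⟩) r.2 := by
  obtain ⟨u, i⟩ := r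
  simp only [mulVec, dotProduct, Fintype.sum_sigma]
  rw [Finset.sum_eq_single u]
  · simp [blockDiagonal'_apply_eq]
  · intro u' _ hu
    refine Finset.sum_eq_zero fun j _ => ?_
    rw [blockDiagonal'_apply_ne M i j hu.symm, zero_mul]
  · simp

theorem relu_sub_relu_neg (z : ℝ) : relu z - relu (-z) = z := by
  unfold relu
  rcases le_total 0 z with h | h
  · rw [max_eq_right h, max_eq_left (by linarith)]; ring
  · rw [max_eq_left h, max_eq_right (by linarith)]; ring

theorem relu_relu (z : ℝ) : relu (relu z) = relu z := by simp [relu]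

theorem Finset.sum_bool_sgn (f : Bool → ℝ) :
    ∑ b, FESystem.sgn b * f b = f true - f false := by
  simp [FESystem.sgn, sub_eq_add_neg]

theorem relu_sgn (z : ℝ) : ∑ b, FESystem.sgn b * relu (FESystem.sgn b * z) = z := by
  rw [Finset.sum_bool_sgn fun b => relu (FESystem.sgn b * z)]
  simpa [FESystem.sgn] using relu_sub_relu_neg z

/-- Multiplication with an indicator by relu units. -/
theorem relu_mul_indicator {z κ : ℝ} (hz : |z| ≤ κ) (P : Prop) [Decidable P] :
    ∑ b, FESystem.sgn b * relu (κ * (if P then 1 else 0) + FESystem.sgn b * z - κ) =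
      if P then z else 0 := by
  rw [Finset.sum_bool_sgn fun b => relu (κ * (if P then 1 else 0) + FESystem.sgn b * z - κ)]
  have := abs_le.1 hz
  split_ifs
  · simpa [FESystem.sgn] using relu_sub_relu_neg z
  · simp only [FESystem.sgn, relu]
    -- With indicator zero the arguments are `±z - κ ≤ 0`, so both units are silent.
    rw [max_eq_left, max_eq_left] <;> simp <;> linarith

/-- The inner sum counts the positive `f i`. It is `d + 1` if all are positive and at most `d`
otherwise; the threshold `d + 1 - 1/4` separates the two. -/
theorem bisu_sum {ι : Type*} [Fintype ι] {d : ℕ} (hc : Fintype.card ι = d + 1) (f : ι → ℝ)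
    [Decidable (∀ i, 0 < f i)] :
    bisu (∑ i, bisu (f i) + -((d : ℝ) + 1 - 1 / 4)) = if ∀ i, 0 < f i then 1 else 0 := by
  have hle : ∀ i, bisu (f i) ≤ 1 := fun i => by unfold bisu; split_ifs <;> norm_num
  split_ifs with h
  · have h1 : ∀ i, bisu (f i) = 1 := fun i => if_neg (not_le.2 (h i))
    simp only [h1, Finset.sum_const, Finset.card_univ, hc, nsmul_eq_mul, mul_one]
    rw [bisu, if_neg]
    push_cast
    linarith
  · push Not at h
    obtain ⟨i, hi⟩ := h
    have h1 : ∑ j, bisu (f j) ≤ d := by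
      rw [← Finset.add_sum_erase _ _ (Finset.mem_univ i), bisu, if_pos hi, zero_add]
      refine (Finset.sum_le_sum fun j _ => hle j).trans ?_
      simp [hc]
    rw [bisu, if_pos]
    linarith

/-! ### Cells and the domain up to null sets. -/

namespace RegularPartition

variable {d : ℕ} {D : Set (Eu d)}

theorem isCompact_closure (T : RegularPartition D) : IsCompact (closure D) := by
  rw [← T.cover]
  exact T.cells.isCompact_biUnion fun K _ => K.finite_toSet.isCompact_convexHull ℝ

variable (T : RegularPartition D)

/-- The cells cover `D`, and the frontier of a convex set is a null set. -/
theorem ae_mem_interior (hDo : IsOpen D) : ∀ᵐ x ∂volume.restrict D, x ∈ D ∧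
    ∃ K : T.cells, x ∈ interior (convexHull ℝ ((K : Finset (Eu d)) : Set (Eu d))) := by
  have h1 : ∀ᵐ x ∂volume.restrict D, ∀ K : T.cells,
      x ∉ frontier (convexHull ℝ ((K : Finset (Eu d)) : Set (Eu d))) := by
    refine ae_all_iff.2 fun K => ae_restrict_of_ae ?_
    exact measure_eq_zero_iff_ae_notMem.1 ((convex_convexHull ℝ _).addHaar_frontier volume)
  filter_upwards [h1, ae_restrict_mem hDo.measurableSet] with x hx hxD
  refine ⟨hxD, ?_⟩
  have h2 := subset_closure hxD
  rw [← T.cover] at h2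
  obtain ⟨K, hK, hxK⟩ := Set.mem_iUnion₂.1 h2
  refine ⟨⟨K, hK⟩, ?_⟩
  rw [← self_sdiff_frontier]
  exact ⟨hxK, hx ⟨K, hK⟩⟩

theorem nonempty_interior_inter (K : T.cells) :
    (interior (convexHull ℝ ((K : Finset (Eu d)) : Set (Eu d))) ∩ D).Nonempty := by
  have h1 : (interior (convexHull ℝ ((K : Finset (Eu d)) : Set (Eu d)))).Nonempty :=
    interior_convexHull_nonempty_iff_affineSpan_eq_top.2 (T.span_cell K)
  obtain ⟨x, hx⟩ := h1
  refine mem_closure_iff.1 ?_ _ isOpen_interior hx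
  rw [← T.cover]
  exact Set.mem_iUnion₂.2 ⟨K, K.2, interior_subset hx⟩

end RegularPartition

theorem FEKind.IsLocal.continuous {d : ℕ} {k : FEKind} {p : Eu d → Fin (k.comps d) → ℝ}
    (hp : k.IsLocal p) : Continuous p := by
  obtain ⟨A, hA⟩ := hp.exists_affine
  rw [← funext hA]
  exact A.continuous_of_finiteDimensional

/-! ### The realization of the networks. -/

namespace FESystem

variable {d : ℕ} {D : Set (Eu d)} {T : RegularPartition D} {m : ℕ} (S : FESystem T m)
  (o : T.Orientation)

theorem piece_isLocal (u : S.Block) : (S.kind u.1).IsLocal (S.piece o u) :=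
  FEKind.shape_isLocal o _ _ _

/-- The supremum in `kappa` is finite because the piece is continuous on the compact closure of `D`;
an unbounded set would give the default value of `sSup`. -/
theorem abs_piece_le_kappa (u : S.Block) {x : Eu d} (hx : x ∈ D) (j : Fin u.width) :
    |S.piece o u x j| ≤ S.kappa o u := by
  have hb : BddAbove ((fun x => ‖S.piece o u x‖) '' D) :=
    (T.isCompact_closure.bddAbove_image
      (S.piece_isLocal o u).continuous.norm.continuousOn).mono (Set.image_mono subset_closure)
  exact (norm_le_pi_norm (S.piece o u x) j).trans (le_csSup hb ⟨x, hx, rfl⟩)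

theorem piece_eq_coord (u : S.Block) (x : Eu d) (j : Fin u.width) :
    ∑ l, (S.piece o u (EuclideanSpace.single l 1) j - S.piece o u 0 j) * x l +
      S.piece o u 0 j = S.piece o u x j := by
  obtain ⟨A, hA⟩ := (S.piece_isLocal o u).exists_affine
  have := RegularPartition.affine_eq_coord
    ((LinearMap.proj (R := ℝ) (φ := fun _ => ℝ) j).toAffineMap.comp A) x
  simp only [AffineMap.coe_comp, LinearMap.coe_toAffineMap, Function.comp_apply, hA,
    LinearMap.proj_apply] at this
  rw [this, add_comm]

/-- The inputs of the first hidden layer: barycentric coordinates and signed pieces. -/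
theorem layer₁ (x : Eu d) (r) :
    (S.A₁ o *ᵥ (fun l => x l) + S.b₁ o) r =
      Sum.elim (fun a : (r.1.cell : Finset (Eu d)) => T.bary r.1.cell a x)
        (fun q => sgn q.2 * S.piece o r.1 x q.1) r.2 := by
  rcases r with ⟨u, a | ⟨j, b⟩⟩
  · simp only [Pi.add_apply, mulVec, dotProduct, A₁, b₁, of_apply, Sum.elim_inl]
    rw [T.bary_eq u.cell a x, add_comm]
    rfl
  · simp only [Pi.add_apply, mulVec, dotProduct, A₁, b₁, of_apply, Sum.elim_inr]
    rw [← S.piece_eq_coord o u x j, mul_add, Finset.mul_sum]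
    simp only [mul_assoc]

theorem layer₂ (v) (r) :
    ((S.A₂ *ᵥ v + S.b₂) r : ℝ) =
      Sum.elim (fun _ => ∑ a, v ⟨r.1, .inl a⟩ + -((d : ℝ) + 1 - 1 / 4))
        (fun q => v ⟨r.1, .inr q⟩) r.2 := by
  rw [Pi.add_apply, A₂, Matrix.blockDiagonal'_mulVec_apply, fromBlocks_mulVec]
  rcases r with ⟨u, a | q⟩
  · simp [b₂, mulVec, dotProduct]
  · simp [b₂, Function.comp_def]

/-- The passing matrix recombines the two signed channels by a difference and splits the result
again. -/
theorem sum_pass (w : ℕ) (v : Fin w × Bool → ℝ) (p : Fin w × Bool) :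
    ((of fun p q => if p.1 = q.1 then sgn p.2 * sgn q.2 else 0 :
      Matrix (Fin w × Bool) (Fin w × Bool) ℝ) *ᵥ v) p =
      sgn p.2 * ∑ b, sgn b * v (p.1, b) := by
  simp only [mulVec, dotProduct, of_apply, Fintype.sum_prod_type]
  rw [Finset.sum_eq_single p.1]
  · rw [Finset.mul_sum]
    exact Finset.sum_congr rfl fun b _ => by rw [if_pos rfl, mul_assoc]
  · intro j _ hj
    exact Finset.sum_eq_zero fun b _ => by rw [if_neg hj.symm, zero_mul]
  · simp

theorem layer₃ (v) (r) :
    ((S.A₃ *ᵥ v + 0) r : ℝ) =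
      Sum.elim (fun b => sgn b * v ⟨r.1, .inl ()⟩)
        (fun q => sgn q.2 * ∑ b, sgn b * v ⟨r.1, .inr (q.1, b)⟩) r.2 := by
  rw [add_zero, A₃, Matrix.blockDiagonal'_mulVec_apply, fromBlocks_mulVec]
  rcases r with ⟨u, a | q⟩
  · simp [mulVec, dotProduct]
  · simp [sum_pass, Function.comp_def]

theorem layer₄ (v) (r) :
    ((S.A₄ o *ᵥ v + S.b₄ o) r : ℝ) =
      S.kappa o r.1 * ∑ b, sgn b * v ⟨r.1, .inl b⟩ +
        sgn r.2.2 * ∑ b, sgn b * v ⟨r.1, .inr (r.2.1, b)⟩ - S.kappa o r.1 := by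
  rw [Pi.add_apply, A₄, Matrix.blockDiagonal'_mulVec_apply, fromCols_mulVec, Pi.add_apply,
    sum_pass, b₄, ← sub_eq_add_neg]
  congr 2
  simp only [mulVec, dotProduct, of_apply, Finset.mul_sum, Function.comp_apply, mul_assoc]

theorem layer₅ (coef : S.Dof → ℝ) (v) (i : S.Comp) :
    ((S.A₅ coef *ᵥ v + 0) i : ℝ) = ∑ u : S.Block, ∑ j, if i = ⟨u.1, j⟩ then
      coef u.dof * ∑ b, sgn b * v ⟨u, j, b⟩ else 0 := by
  rw [add_zero]
  simp only [mulVec, dotProduct, A₅, of_apply]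
  rw [Fintype.sum_sigma]
  simp only [Fintype.sum_prod_type]
  refine Finset.sum_congr rfl fun u _ => Finset.sum_congr rfl fun j _ => ?_
  split_ifs
  · simp only [Finset.mul_sum, mul_assoc]
  · simp

/-- The network sums the pieces times the indicator functions of the cells. -/
theorem realize_net (coef : S.Dof → ℝ) {x : Eu d} (hx : x ∈ D) (i : S.Comp) :
    (S.net o coef).realize (fun l => x l) i = ∑ u : S.Block, ∑ j, if i = ⟨u.1, j⟩ then
      coef u.dof * (if x ∈ interior (convexHull ℝ ((u.cell : Finset (Eu d)) : Set (Eu d))) then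
        S.piece o u x j else 0) else 0 := by
  simp only [net, NeuralNet.realize]
  rw [layer₅]
  refine Finset.sum_congr rfl fun u _ => Finset.sum_congr rfl fun j _ => ?_
  refine if_congr Iff.rfl (congrArg _ ?_) rfl
  simp only [layer₄, layer₃, layer₂, layer₁, Sum.elim_inl, Sum.elim_inr, relu_relu, relu_sgn]
  have hc : Fintype.card (u.cell : Finset (Eu d)) = d + 1 := by
    simpa using T.card_cell u.cell u.cell.2
  have h1 := relu_mul_indicator (S.abs_piece_le_kappa o u hx j)
    (∀ a : (u.cell : Finset (Eu d)), 0 < T.bary u.cell a x)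
  have h2 : (if ∀ a : (u.cell : Finset (Eu d)), 0 < T.bary u.cell a x then (1 : ℝ) else 0) =
      bisu (∑ a : (u.cell : Finset (Eu d)), bisu (T.bary u.cell a x) +
        -((d : ℝ) + 1 - 1 / 4)) := by
    rw [bisu_sum hc fun a => T.bary u.cell a x]
  rw [h2] at h1
  rw [T.interior_hull]
  convert h1
  · exact relu_sgn _
  · exact Iff.rfl

theorem realize_net_of_mem_interior (coef : S.Dof → ℝ) {x : Eu d} (hx : x ∈ D) {K : T.cells}
    (hK : x ∈ interior (convexHull ℝ ((K : Finset (Eu d)) : Set (Eu d)))) (k : Fin m)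
    (j : Fin ((S.kind k).comps d)) :
    (S.net o coef).realize (fun l => x l) ⟨k, j⟩ = S.localFun o coef k K x j := by
  have hcell : ∀ u : S.Block,
      x ∈ interior (convexHull ℝ ((u.cell : Finset (Eu d)) : Set (Eu d))) ↔ u.cell = K :=
    fun u => ⟨fun h => T.bary_pos_cell_unique h (interior_subset hK), fun h => h ▸ hK⟩
  simp only [realize_net S o coef hx, hcell, localFun, Finset.sum_apply, Pi.smul_apply,
    smul_eq_mul]
  rw [← Finset.sum_attach (Finset.univ.filter fun s : S.index k => s.1 ⊆ (K : Finset (Eu d)))]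
  symm
  -- A shape function `s` on `K` corresponds to the subnetwork (`s`, `K`). All others contribute
  -- zero, by belonging to another factor or another cell.
  refine Finset.sum_of_injOn (fun s => (⟨k, ⟨(s.1.1, K.1), Finset.mem_filter.2
    ⟨Finset.mem_product.2 ⟨s.1.2, K.2⟩, (Finset.mem_filter.1 s.2).2⟩⟩⟩ : S.Block)) ?_ ?_ ?_ ?_
  · intro s _ t _ h
    exact Subtype.ext (Subtype.ext (by simpa using h))
  · intro s _
    simp
  · rintro ⟨k', ⟨⟨s, K'⟩, hq⟩⟩ - hn
    refine Finset.sum_eq_zero fun j' _ => ?_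
    split_ifs with h1 h2
    · exfalso
      obtain ⟨rfl, h1⟩ := Sigma.mk.inj_iff.1 h1
      have hq' := Finset.mem_filter.1 hq
      have hK' : K' = K.1 := congrArg Subtype.val h2
      subst hK'
      exact hn ⟨⟨⟨s, (Finset.mem_product.1 hq'.1).1⟩, by simpa using hq'.2⟩,
        Finset.mem_coe.2 (Finset.mem_attach _ _), rfl⟩
    · simp
    · rfl
  · intro s _
    rw [Finset.sum_eq_single j]
    · rw [if_pos rfl]
      exact congrArg _ (if_pos rfl).symm
    · intro j' _ hj
      rw [if_neg]
      intro h
      exact hj (eq_of_heq (Sigma.mk.inj_iff.1 h).2).symm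
    · simp

theorem ae_realize_net (hDo : IsOpen D) (coef : S.Dof → ℝ) :
    ∀ᵐ x ∂volume.restrict D, ∀ K : T.cells,
      x ∈ convexHull ℝ ((K : Finset (Eu d)) : Set (Eu d)) →
        ∀ (k : Fin m) j, (S.net o coef).realize (fun l => x l) ⟨k, j⟩ =
          S.localFun o coef k K x j := by
  filter_upwards [T.ae_mem_interior hDo] with x ⟨hxD, K', hK'⟩ K hK k j
  have := T.bary_pos_cell_unique hK' hK
  subst this
  exact S.realize_net_of_mem_interior o coef hxD hK' k j

theorem isFE_realize_net (hd : 0 < d) (hDo : IsOpen D) (coef : S.Dof → ℝ) :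
    S.IsFE fun x => (S.net o coef).realize fun l => x l :=
  (S.isFE_iff o hd _).2 ⟨coef, S.ae_realize_net o hDo coef⟩

/-- A finite element function is realized by a network. -/
theorem exists_net_of_isFE (hd : 0 < d) (hDo : IsOpen D) {f : Eu d → S.Comp → ℝ}
    (hf : S.IsFE f) : ∃ coef : S.Dof → ℝ,
      f =ᵐ[volume.restrict D] fun x => (S.net o coef).realize fun l => x l := by
  obtain ⟨coef, h⟩ := (S.isFE_iff o hd f).1 hf
  refine ⟨coef, ?_⟩
  filter_upwards [h, S.ae_realize_net o hDo coef, T.ae_mem_interior hDo] with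
    x h1 h2 ⟨_, K, hK⟩
  funext ⟨k, j⟩
  rw [h1 K (interior_subset hK), h2 K (interior_subset hK)]

/-- The coefficients are determined by the realization. -/
theorem coef_eq_of_realize_ae_eq (hd : 0 < d) (hDo : IsOpen D) {coef coef' : S.Dof → ℝ}
    (h : (fun x : Eu d => (S.net o coef).realize fun l => x l) =ᵐ[volume.restrict D]
      fun x => (S.net o coef').realize fun l => x l) : coef = coef' := by
  funext ⟨k, s, hs⟩
  obtain ⟨K, hsK, hc⟩ := T.mem_subsimplices.1 (S.index_subset k hs)
  -- `O` is open and nonempty, since the cell lies in the closure of `D`. Continuous functions that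
  -- agree a.e. on `O` agree on `O`, and affine ones then agree everywhere.
  set O := interior (convexHull ℝ ((K : Finset (Eu d)) : Set (Eu d))) ∩ D
  have hO : IsOpen O := isOpen_interior.inter hDo
  have hae : S.localFun o coef k K =ᵐ[volume.restrict O] S.localFun o coef' k K := by
    have h' := ae_restrict_of_ae_restrict_of_subset (Set.inter_subset_right :
      O ⊆ D) h
    filter_upwards [h', ae_restrict_mem hO.measurableSet] with x hx hxO
    funext j
    rw [← S.realize_net_of_mem_interior o coef hxO.2 hxO.1,
      ← S.realize_net_of_mem_interior o coef' hxO.2 hxO.1]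
    exact congrFun hx _
  have hloc := S.localFun_isLocal o coef k K
  have hloc' := S.localFun_isLocal o coef' k K
  have hEq := Measure.eqOn_open_of_ae_eq hae hO hloc.continuous.continuousOn
    hloc'.continuous.continuousOn
  have heq : S.localFun o coef k K = S.localFun o coef' k K := by
    obtain ⟨A, hA⟩ := hloc.exists_affine
    obtain ⟨A', hA'⟩ := hloc'.exists_affine
    funext x
    rw [← hA, ← hA']
    refine AffineMap.eq_of_eqOn_of_span_eq_top
      (hO.affineSpan_eq_top (T.nonempty_interior_inter K)) (fun y hy => ?_) x
    rw [hA, hA']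
    exact hEq hy
  have := congrArg ((S.kind k).dof o s) heq
  rwa [S.dof_localFun o hd _ hsK hc, S.dof_localFun o hd _ hsK hc, dif_pos hs, dif_pos hs] at this

theorem localFun_lin (coef coef' : S.Dof → ℝ) (c : ℝ) (k : Fin m) (K : T.cells) :
    S.localFun o (coef + c • coef') k K = S.localFun o coef k K + c • S.localFun o coef' k K := by
  simp [localFun, Finset.smul_sum, add_smul, Finset.sum_add_distrib, mul_smul]

theorem realize_net_lin (hDo : IsOpen D) (coef coef' : S.Dof → ℝ) (c : ℝ) :
    (fun x : Eu d => (S.net o (coef + c • coef')).realize fun l => x l) =ᵐ[volume.restrict D]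
      fun x => ((S.net o coef).realize fun l => x l) +
        c • (S.net o coef').realize fun l => x l := by
  filter_upwards [T.ae_mem_interior hDo] with x ⟨hxD, K, hK⟩
  funext ⟨k, j⟩
  simp [S.realize_net_of_mem_interior o _ hxD hK, localFun_lin]

end FESystem

/-! ### Least squares and quasi-optimality. -/

/-- Pythagoras for the best approximation. -/
theorem Submodule.norm_sub_sq_eq_add_starProjection {H : Type*} [NormedAddCommGroup H]
    [InnerProductSpace ℝ H] (M : Submodule ℝ H) [M.HasOrthogonalProjection] (F : H) {w : H}
    (hw : w ∈ M) :
    ‖F - w‖ ^ 2 = ‖F - M.starProjection F‖ ^ 2 + ‖M.starProjection F - w‖ ^ 2 := by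
  have h1 : inner ℝ (F - M.starProjection F) (M.starProjection F - w) = 0 := by
    rw [real_inner_comm]
    exact (M.sub_starProjection_mem_orthogonal F) _
      (M.sub_mem (M.starProjection_apply_mem F) hw)
  have h2 := norm_add_sq_real (F - M.starProjection F) (M.starProjection F - w)
  rw [h1, sub_add_sub_cancel] at h2
  linarith

theorem mainTheorem3 {d : ℕ} (hd : 2 ≤ d) {D : Set (Eu d)} (hDo : IsOpen D) (hDc : IsConnected D)
    (T : RegularPartition D) (o : T.Orientation) {m : ℕ} (S : FESystem T m)
    {V : Type*} [NormedAddCommGroup V] [InnerProductSpace ℝ V] [CompleteSpace V]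
    (J : V →ₗ[ℝ] (Eu d →ₘ[volume.restrict D] (S.Comp → ℝ))) (hJ : Function.Injective J)
    (hconf : ∀ f : Eu d → S.Comp → ℝ, S.IsFE f → ∃ v : V, J v =ᵐ[volume.restrict D] f)
    {n : ℕ} {dim : Fin n → ℕ} (D' : (i : Fin n) → Set (Eu (dim i)))
    (L : V →L[ℝ] PiLp 2 fun i => Lp ℝ 2 (volume.restrict (D' i)))
    (c C : ℝ) (hc : 0 < c) (hcC : c ≤ C)
    (hL : ∀ v : V, c * ‖v‖ ≤ ‖L v‖ ∧ ‖L v‖ ≤ C * ‖v‖)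
    (F : PiLp 2 fun i => Lp ℝ 2 (volume.restrict (D' i))) (U : V) (hU : L U = F) :
    ∃ R : S.NN o → V,
      (∀ Φ : S.NN o, J (R Φ) =ᵐ[volume.restrict D] fun x => Φ.1.realize fun l => x l) ∧
      Function.Injective R ∧ Set.range R = S.space J ∧
      (∀ Φ : S.NN o, c * ‖U - R Φ‖ ≤ ‖F - L (R Φ)‖ ∧ ‖F - L (R Φ)‖ ≤ C * ‖U - R Φ‖) ∧
      (∃! Φ : S.NN o, IsMinOn (fun Ψ : S.NN o => ‖F - L (R Ψ)‖ ^ 2) Set.univ Φ) ∧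
      ∀ Φ : S.NN o, IsMinOn (fun Ψ : S.NN o => ‖F - L (R Ψ)‖ ^ 2) Set.univ Φ →
        ∃ ε : ℝ,
          IsLeast (Set.range fun Ψ : S.NN o => ‖U - R Ψ‖) ε ∧
          IsLeast ((fun v : V => ‖U - v‖) '' S.space J) ε ∧
          IsLeast (Set.range fun Ψ : S.NN o => ‖F - L (R Ψ)‖) ‖F - L (R Φ)‖ ∧
          c * ‖U - R Φ‖ ≤ ‖F - L (R Φ)‖ ∧
          ‖F - L (R Φ)‖ ≤ C * ε ∧
          ‖U - R Φ‖ ≤ C / c * ε := by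
  have hd0 : 0 < d := by omega
  choose R₀ hR₀ using fun coef : S.Dof → ℝ => hconf _ (S.isFE_realize_net o hd0 hDo coef)
  have hinj₀ : Function.Injective R₀ := fun a b hab =>
    S.coef_eq_of_realize_ae_eq o hd0 hDo ((hR₀ a).symm.trans (hab ▸ hR₀ b))
  -- Linearity holds a.e. for the realizations, and injectivity of `J` lifts it to `V`. The range is
  -- thus a finite-dimensional subspace.
  have hlin : ∀ a b (t : ℝ), R₀ (a + t • b) = R₀ a + t • R₀ b := fun a b t => by
    refine hJ (AEEqFun.ext ?_)
    rw [map_add, map_smul]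
    filter_upwards [hR₀ (a + t • b), hR₀ a, hR₀ b, S.realize_net_lin o hDo a b t,
      AEEqFun.coeFn_add (J (R₀ a)) (t • J (R₀ b)), AEEqFun.coeFn_smul t (J (R₀ b))]
      with x h1 h2 h3 h4 h5 h6
    rw [h1, h4, h5, Pi.add_apply, h6, Pi.smul_apply, h2, h3]
  have hzero : R₀ 0 = 0 := by
    have := hlin 0 0 1
    simpa using this
  let E : (S.Dof → ℝ) →ₗ[ℝ] V :=
    { toFun := R₀
      map_add' := fun a b => by simpa using hlin a b 1
      map_smul' := fun t a => by simpa [hzero] using hlin 0 a t }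
  have hspace : S.space J = (LinearMap.range E : Set V) := by
    ext v
    constructor
    · intro hv
      obtain ⟨coef, h⟩ := S.exists_net_of_isFE o hd0 hDo hv
      exact ⟨coef, hJ (AEEqFun.ext ((hR₀ coef).trans h.symm))⟩
    · rintro ⟨coef, rfl⟩
      obtain ⟨coef', h⟩ := (S.isFE_iff o hd0 _).1 (S.isFE_realize_net o hd0 hDo coef)
      refine (S.isFE_iff o hd0 _).2 ⟨coef', ?_⟩
      filter_upwards [h, hR₀ coef] with x h1 h2 K hK k j
      rw [← h1 K hK k j]
      exact congrFun h2 _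
  have hnet : ∀ Φ : S.NN o, ∃ coef, S.net o coef = Φ.1 := fun Φ => Φ.2
  choose co hco using hnet
  have hcoinj : Function.Injective co := fun Φ Ψ h =>
    Subtype.ext (by rw [← hco Φ, ← hco Ψ, h])
  -- Equal networks have equal realizations, hence equal coefficients, so `co` inverts `S.net o`.
  have hcosurj : ∀ coef, ∃ Φ, co Φ = coef := fun coef =>
    ⟨⟨S.net o coef, coef, rfl⟩, S.coef_eq_of_realize_ae_eq o hd0 hDo (by rw [hco])⟩
  let R : S.NN o → V := fun Φ => R₀ (co Φ)
  have hRinj : Function.Injective R := hinj₀.comp hcoinj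
  have hRrange : Set.range R = (LinearMap.range E : Set V) := by
    ext v
    constructor
    · rintro ⟨Φ, rfl⟩
      exact ⟨co Φ, rfl⟩
    · rintro ⟨coef, rfl⟩
      obtain ⟨Φ, rfl⟩ := hcosurj coef
      exact ⟨Φ, rfl⟩
  have hbound : ∀ v, c * ‖U - v‖ ≤ ‖F - L v‖ ∧ ‖F - L v‖ ≤ C * ‖U - v‖ := fun v => by
    rw [← hU, ← map_sub]
    exact hL _
  have hLinj : Function.Injective L := by
    refine (injective_iff_map_eq_zero L).2 fun v hv => norm_le_zero_iff.1 ?_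
    have := (hL v).1
    rw [hv, norm_zero] at this
    nlinarith [norm_nonneg v]
  set W := LinearMap.range E with hW
  have hRW : ∀ Φ, R Φ ∈ W := fun Φ => by
    have : R Φ ∈ Set.range R := ⟨Φ, rfl⟩
    rwa [hRrange] at this
  have hWR : ∀ w ∈ W, ∃ Φ, R Φ = w := fun w hw => by
    have : w ∈ Set.range R := by rw [hRrange]; exact hw
    exact this
  set M := W.map L.toLinearMap with hM
  have hLM : ∀ Φ, L (R Φ) ∈ M := fun Φ => Submodule.mem_map_of_mem (hRW Φ)
  -- The minimizer: `M` is finite-dimensional, so the projection of `F` exists and is attained by a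
  -- network.
  obtain ⟨w₀, hw₀, hLw₀⟩ := Submodule.mem_map.1 (M.starProjection_apply_mem F)
  obtain ⟨Φ₀, rfl⟩ := hWR w₀ hw₀
  have hpyth : ∀ Φ, ‖F - L (R Φ)‖ ^ 2 =
      ‖F - L (R Φ₀)‖ ^ 2 + ‖L (R Φ₀) - L (R Φ)‖ ^ 2 := fun Φ => by
    rw [M.norm_sub_sq_eq_add_starProjection F (hLM Φ), ← hLw₀]
    rfl
  have hmin₀ : IsMinOn (fun Ψ : S.NN o => ‖F - L (R Ψ)‖ ^ 2) Set.univ Φ₀ := fun Φ _ => by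
    change ‖F - L (R Φ₀)‖ ^ 2 ≤ ‖F - L (R Φ)‖ ^ 2
    rw [hpyth Φ]
    exact le_add_of_nonneg_right (sq_nonneg _)
  have huniq : ∀ Φ, IsMinOn (fun Ψ : S.NN o => ‖F - L (R Ψ)‖ ^ 2) Set.univ Φ → Φ = Φ₀ := by
    intro Φ hΦ
    have h1 : ‖F - L (R Φ)‖ ^ 2 ≤ ‖F - L (R Φ₀)‖ ^ 2 := hΦ (Set.mem_univ Φ₀)
    rw [hpyth Φ] at h1
    have h2 : ‖L (R Φ₀) - L (R Φ)‖ ^ 2 = 0 := le_antisymm (by linarith) (sq_nonneg _)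
    rw [sq_eq_zero_iff, norm_eq_zero, sub_eq_zero] at h2
    exact (hRinj (hLinj h2)).symm
  refine ⟨R, fun Φ => ?_, hRinj, hRrange.trans hspace.symm, fun Φ => hbound _,
    ⟨Φ₀, hmin₀, huniq⟩, fun Φ hΦ => ?_⟩
  · have := hR₀ (co Φ)
    rwa [hco] at this
  -- `Ψ` realizes the best approximation of `U` in the norm of `V`, and `ε` is its error.
  · obtain ⟨Ψ, hΨ⟩ := hWR _ (W.starProjection_apply_mem U)
    have hbest : ∀ w ∈ W, ‖U - R Ψ‖ ≤ ‖U - w‖ := fun w hw => by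
      refine (pow_le_pow_iff_left₀ (norm_nonneg _) (norm_nonneg _) two_ne_zero).1 ?_
      rw [W.norm_sub_sq_eq_add_starProjection U hw, hΨ]
      exact le_add_of_nonneg_right (sq_nonneg _)
    have hleast : ∀ Φ', ‖F - L (R Φ)‖ ≤ ‖F - L (R Φ')‖ := fun Φ' =>
      (pow_le_pow_iff_left₀ (norm_nonneg _) (norm_nonneg _) two_ne_zero).1
        (hΦ (Set.mem_univ Φ'))
    have hquasi : ‖F - L (R Φ)‖ ≤ C * ‖U - R Ψ‖ := (hleast Ψ).trans (hbound _).2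
    refine ⟨‖U - R Ψ‖, ⟨⟨Ψ, rfl⟩, ?_⟩, ⟨⟨R Ψ, ?_, rfl⟩, ?_⟩, ⟨⟨Φ, rfl⟩, ?_⟩, (hbound _).1,
      hquasi, ?_⟩
    · rintro _ ⟨Φ', rfl⟩
      exact hbest _ (hRW Φ')
    · rw [hspace]
      exact hRW Ψ
    · rintro _ ⟨v, hv, rfl⟩
      rw [hspace] at hv
      exact hbest v hv
    · rintro _ ⟨Φ', rfl⟩
      exact hleast Φ'
    · rw [div_mul_eq_mul_div, le_div_iff₀ hc, mul_comm]
      exact (hbound _).1.trans hquasi
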